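/- Let $N,m,r\in\mathbb N$. Let $\mathfrak{her}_0(N)$ be the real vector space of traceless Hermitian $N\times N$ matrices with the Hilbert–Schmidt inner product $\langle X,Y\rangle=\operatorname{tr}(XY)$. Let $H_d,H_1,\dots,H_m\in\mathfrak{her}_0(N)$ and $V_1,\dots,V_r\in\mathbb C^{N\times N}$, and put $H_u=H_d+\sum_j u_jH_j$ for $u\in\mathbb R^m$ and $$\Gamma_L(\rho)=\tfrac12\sum_k\big(V_k^\dagger V_k\rho+\rho V_k^\dagger V_k-2V_k\rho V_k^\dagger\big).$$ Assume unitality, $\Gamma_L(\mathbf 1)=0$. Let $\mathcal L_u=\mathrm i\,\mathrm{ad}_{H_u}+\Gamma_L$ act on $\mathfrak{her}_0(N)$ and let $$\mathbf P_\Sigma=\big\langle \exp(-t\mathcal L_u)\ \big|\ t\ge0,\ u\in\mathbb R^m\big\rangle_S\subset GL(\mathfrak{her}_0(N))$$ be the semigroup generated by these operators (the system semigroup of $\dot\rho=-\mathcal L_u\rho$). Write $\mathrm{ad}_{\mathfrak{su}(N)}=\{\rho\mapsto[Y,\rho] : Y^\dagger=-Y,\ \operatorname{tr}Y=0\}$ and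 $\mathrm{Ad}_U\rho=U\rho U^{-1}$ for operators on $\mathfrak{her}_0(N)$. For a closed subsemigroup $\mathbf S\ni\mathbf 1$ of $GL(\mathfrak{her}_0(N))$, its Lie wedge $L(\mathbf S)$ is the set of all $\dot\gamma(0)$, where $\gamma:[0,\infty)\to GL(\mathfrak{her}_0(N))$ is a smooth curve with values in $\mathbf S$ and $\gamma(0)=\mathbf 1$; $\mathbf S$ is called a Lie subsemigroup if it is the closure of the semigroup generated by $\exp L(\mathbf S)$. Closures are taken in $GL(\mathfrak{her}_0(N))$. Suppose there is a pointed cone $\mathfrak c$ (a closed convex cone with $\mathfrak c\cap(-\mathfrak c)=\{0\}$) consisting of self-adjoint positive semidefinite linear operators on $\mathfrak{her}_0(N)$ such that 1. $\Gamma_L|_{\mathfrak{her}_0(N)}\in\mathfrak c$; 2. $[\mathfrak c,\mathfrak c]\subset\mathrm{ad}_{\mathfrak{su}(N)}$ and $[\mathfrak c,\mathrm{ad}_{\mathfrak{su}(N)}]\subset\mathfrak c-\mathfrak c$; 3. $\mathrm{Ad}_U\,\mathfrak c\,\mathrm{Ad}_{U^{-1}}\subset\mathfrak c$ for all $U\in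 SU(N)$. Then $\overline{\mathbf P}_\Sigma$ is a Lie subsemigroup of $GL(\mathfrak{her}_0(N))$, and it is contained in the set $$\exp(-\mathfrak c)\cdot\mathrm{Ad}_{SU(N)}=\{\exp(-C)\,\mathrm{Ad}_U : C\in\mathfrak c,\ U\in SU(N)\},$$ which is itself a Lie subsemigroup of $GL(\mathfrak{her}_0(N))$ whose Lie wedge is $(-\mathfrak c)\oplus\mathrm{ad}_{\mathfrak{su}(N)}$; the sum is direct in the sense that $\operatorname{span}_{\mathbb R}(\mathfrak c)\cap\mathrm{ad}_{\mathfrak{su}(N)}=\{0\}$. -/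

import Mathlib

open Set Topology
open scoped ContDiff Pointwise

noncomputable section

/-! ### Lie subsemigroups of the unit group of a Banach algebra -/

section LieSemigroup

variable {A : Type*} [NormedRing A] [NormedAlgebra ℝ A] [CompleteSpace A]

/-- The exponential map `𝔤𝔩 → GL`, with values in the group of units `Aˣ`. -/
def expUnit (x : A) : Aˣ where
  val := NormedSpace.exp x
  inv := NormedSpace.exp (-x)
  val_inv := by
    let _ : NormedAlgebra ℚ A := NormedAlgebra.restrictScalars ℚ ℝ A
    rw [← NormedSpace.exp_add_of_commute (Commute.refl x).neg_right]; simp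
  inv_val := by
    let _ : NormedAlgebra ℚ A := NormedAlgebra.restrictScalars ℚ ℝ A
    rw [← NormedSpace.exp_add_of_commute (Commute.refl x).neg_left]; simp

/-- The tangent cone `L(S)` at the identity (called the Lie wedge of `S` if `S` is a closed
subsemigroup): all initial velocities of smooth curves `γ : [0, ∞) → Aˣ` which start at `1`
and stay in `S`. -/
def tangentCone (S : Set Aˣ) : Set A :=
  {g | ∃ γ : ℝ → Aˣ,
    ContDiffOn ℝ ∞ (fun t => (γ t : A)) (Ici 0) ∧
    γ 0 = 1 ∧
    (∀ t, 0 ≤ t → γ t ∈ S) ∧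
    HasDerivWithinAt (fun t => (γ t : A)) g (Ici 0) 0}

/-- `S` is a Lie subsemigroup of `Aˣ`: a closed subsemigroup (containing the identity) which is
the closure of the semigroup generated by `exp L(S)`. -/
structure IsLieSubsemigroup (S : Set Aˣ) : Prop where
  one_mem : 1 ∈ S
  mul_mem : ∀ x ∈ S, ∀ y ∈ S, x * y ∈ S
  isClosed : IsClosed S
  eq_closure : S = closure (Submonoid.closure (expUnit '' tangentCone S) : Set Aˣ)

end LieSemigroup

/-! ### Traceless Hermitian matrices and superoperators -/

/-- The traceless Hermitian `N × N` matrices, as a real subspace of all matrices. -/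
def her0Submodule (N : ℕ) : Submodule ℝ (Matrix (Fin N) (Fin N) ℂ) where
  carrier := {X | X.conjTranspose = X ∧ X.trace = 0}
  zero_mem' := by simp
  add_mem' := by
    rintro X Y ⟨hX, hX'⟩ ⟨hY, hY'⟩
    simp [hX, hX', hY, hY']
  smul_mem' := by
    rintro r X ⟨hX, hX'⟩
    simp [hX, hX', Matrix.conjTranspose_smul]

/-- The real vector space `𝔥𝔢𝔯₀(N)`. A type of its own, so that it carries only the norm that
comes from the Hilbert-Schmidt inner product below. -/
def Her0 (N : ℕ) : Type := her0Submodule N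

namespace Her0

open scoped ComplexOrder

variable {N : ℕ}

instance : AddCommGroup (Her0 N) := inferInstanceAs (AddCommGroup (her0Submodule N))

instance : Module ℝ (Her0 N) := inferInstanceAs (Module ℝ (her0Submodule N))

/-- The inclusion of `𝔥𝔢𝔯₀(N)` into the matrices. -/
def toMatrix : Her0 N →ₗ[ℝ] Matrix (Fin N) (Fin N) ℂ := (her0Submodule N).subtype

instance : CoeOut (Her0 N) (Matrix (Fin N) (Fin N) ℂ) := ⟨fun X => toMatrix X⟩

theorem conjTranspose_coe (X : Her0 N) : (toMatrix X).conjTranspose = toMatrix X := X.2.1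

theorem trace_coe (X : Her0 N) : (toMatrix X).trace = 0 := X.2.2

theorem toMatrix_injective : Function.Injective (toMatrix (N := N)) :=
  Subtype.val_injective

instance : FiniteDimensional ℝ (Her0 N) :=
  inferInstanceAs (FiniteDimensional ℝ (her0Submodule N))

/-- The Hilbert-Schmidt inner product `⟪X, Y⟫ = tr (X Y)` on `𝔥𝔢𝔯₀(N)`. (For Hermitian matrices
this trace is real.) -/
@[reducible] def innerCore : InnerProductSpace.Core ℝ (Her0 N) where
  inner X Y := (toMatrix X * toMatrix Y).trace.re
  conj_inner_symm X Y := by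
    rw [Matrix.trace_mul_comm]; simp
  re_inner_nonneg X := by
    have h := (Matrix.posSemidef_conjTranspose_mul_self (toMatrix X)).trace_nonneg
    rw [conjTranspose_coe] at h
    exact (Complex.le_def.1 h).1
  add_left X Y Z := by
    simp [add_mul]
  smul_left X Y r := by
    simp
  definite X h := by
    have h0 := (Matrix.posSemidef_conjTranspose_mul_self (toMatrix X)).trace_nonneg
    have h1 := Matrix.trace_conjTranspose_mul_self_eq_zero_iff (A := toMatrix X)
    rw [conjTranspose_coe] at h0 h1
    have h2 : (toMatrix X * toMatrix X).trace = 0 :=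
      Complex.ext h (Complex.le_def.1 h0).2.symm
    exact toMatrix_injective (by rw [h1.1 h2, map_zero])

instance : NormedAddCommGroup (Her0 N) := innerCore.toNormedAddCommGroup

instance : InnerProductSpace ℝ (Her0 N) := InnerProductSpace.ofCore innerCore.toCore

end Her0

/-- Linear operators on `𝔥𝔢𝔯₀(N)`, i.e. `𝔤𝔩(𝔥𝔢𝔯₀(N))`; the group of units is `GL(𝔥𝔢𝔯₀(N))`. -/
abbrev SuperOp (N : ℕ) : Type := Her0 N →L[ℝ] Her0 N

variable {N : ℕ}

/-- The restriction to `𝔥𝔢𝔯₀(N)` of a linear operator on matrices that leaves it invariant. -/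
def restrictHer0 (f : Matrix (Fin N) (Fin N) ℂ →ₗ[ℝ] Matrix (Fin N) (Fin N) ℂ)
    (hf : ∀ X : Matrix (Fin N) (Fin N) ℂ,
      X.conjTranspose = X → X.trace = 0 → (f X).conjTranspose = f X ∧ (f X).trace = 0) :
    SuperOp N :=
  LinearMap.toContinuousLinearMap
    (f.restrict (p := her0Submodule N) (q := her0Submodule N) fun X hX => hf X hX.1 hX.2 :
      Her0 N →ₗ[ℝ] Her0 N)

theorem toMatrix_restrictHer0 (f : Matrix (Fin N) (Fin N) ℂ →ₗ[ℝ] Matrix (Fin N) (Fin N) ℂ)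
    (hf) (X : Her0 N) :
    Her0.toMatrix (restrictHer0 f hf X) = f (Her0.toMatrix X) := rfl

/-! ### The unitary part: `ad 𝔰𝔲(N)` and `Ad SU(N)` -/

/-- The commutator `ρ ↦ [Y, ρ] = Y ρ - ρ Y` on all matrices. -/
def commutator₀ (Y : Matrix (Fin N) (Fin N) ℂ) :
    Matrix (Fin N) (Fin N) ℂ →ₗ[ℝ] Matrix (Fin N) (Fin N) ℂ where
  toFun X := Y * X - X * Y
  map_add' X Z := by simp only [mul_add, add_mul]; abel
  map_smul' r X := by simp [smul_sub]

/-- The operator `ad_Y : 𝔥𝔢𝔯₀(N) → 𝔥𝔢𝔯₀(N)`, `ρ ↦ [Y, ρ]`, for a skew-Hermitian matrix `Y`. -/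
def adOp (Y : Matrix (Fin N) (Fin N) ℂ) (hY : Y.conjTranspose = -Y) : SuperOp N :=
  restrictHer0 (commutator₀ Y) fun X hX _ => by
    refine ⟨?_, ?_⟩
    · simp only [commutator₀, LinearMap.coe_mk, AddHom.coe_mk, Matrix.conjTranspose_sub,
        Matrix.conjTranspose_mul, hX, hY]
      noncomm_ring
    · simp only [commutator₀, LinearMap.coe_mk, AddHom.coe_mk, Matrix.trace_sub]
      rw [Matrix.trace_mul_comm, sub_self]

/-- `ad 𝔰𝔲(N) = {ad_Y | Y skew-Hermitian and traceless}`, a real subspace of `𝔤𝔩(𝔥𝔢𝔯₀(N))`. -/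
def adSu (N : ℕ) : Submodule ℝ (SuperOp N) where
  carrier := {T | ∃ (Y : Matrix (Fin N) (Fin N) ℂ) (hY : Y.conjTranspose = -Y),
    Y.trace = 0 ∧ T = adOp Y hY}
  zero_mem' := by
    refine ⟨0, by simp, by simp, ?_⟩
    ext1 X
    apply Her0.toMatrix_injective
    simp [adOp, toMatrix_restrictHer0, commutator₀]
  add_mem' := by
    rintro _ _ ⟨Y, hY, hY', rfl⟩ ⟨Z, hZ, hZ', rfl⟩
    refine ⟨Y + Z, by rw [Matrix.conjTranspose_add, hY, hZ]; abel, by simp [hY', hZ'], ?_⟩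
    ext1 X
    apply Her0.toMatrix_injective
    simp only [adOp, toMatrix_restrictHer0, commutator₀, add_apply, map_add,
      LinearMap.coe_mk, AddHom.coe_mk, add_mul, mul_add]
    abel
  smul_mem' := by
    rintro r _ ⟨Y, hY, hY', rfl⟩
    refine ⟨r • Y, by simp [Matrix.conjTranspose_smul, hY], by simp [hY'], ?_⟩
    ext1 X
    apply Her0.toMatrix_injective
    simp [adOp, toMatrix_restrictHer0, commutator₀, smul_sub]

/-- Conjugation `ρ ↦ U ρ U†` by a special unitary matrix, as an operator on `𝔥𝔢𝔯₀(N)`. -/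
def conjSU (U : Matrix.specialUnitaryGroup (Fin N) ℂ) : SuperOp N :=
  restrictHer0
    { toFun := fun X => (U : Matrix (Fin N) (Fin N) ℂ) * X *
        (U : Matrix (Fin N) (Fin N) ℂ).conjTranspose
      map_add' := fun X Z => by simp only [mul_add, add_mul]
      map_smul' := fun r X => by simp }
    fun X hX hX' => by
      have hU : (U : Matrix (Fin N) (Fin N) ℂ).conjTranspose *
          (U : Matrix (Fin N) (Fin N) ℂ) = 1 :=
        Matrix.mem_unitaryGroup_iff'.1 (Matrix.mem_specialUnitaryGroup_iff.1 U.2).1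
      refine ⟨?_, ?_⟩
      · simp [hX, mul_assoc]
      · simp only [LinearMap.coe_mk, AddHom.coe_mk]
        rw [Matrix.trace_mul_comm, ← mul_assoc, hU, one_mul, hX']

/-- `Ad : SU(N) → GL(𝔥𝔢𝔯₀(N))`, `Ad_U ρ = U ρ U⁻¹`. -/
def AdSU (N : ℕ) : Matrix.specialUnitaryGroup (Fin N) ℂ →* (SuperOp N)ˣ :=
  MonoidHom.toHomUnits
    { toFun := conjSU
      map_one' := by
        ext1 X
        apply Her0.toMatrix_injective
        simp [conjSU, toMatrix_restrictHer0]
      map_mul' := fun U W => by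
        ext1 X
        apply Her0.toMatrix_injective
        simp [conjSU, toMatrix_restrictHer0, mul_assoc] }

/-! ### The controlled Lindblad master equation -/

/-- The Kossakowski-Lindblad term
`Γ_L(ρ) = ½ ∑ₖ (Vₖ† Vₖ ρ + ρ Vₖ† Vₖ - 2 Vₖ ρ Vₖ†)` on all matrices. -/
def lindbladTerm {r : ℕ} (V : Fin r → Matrix (Fin N) (Fin N) ℂ) :
    Matrix (Fin N) (Fin N) ℂ →ₗ[ℝ] Matrix (Fin N) (Fin N) ℂ where
  toFun X := (1 / 2 : ℝ) • ∑ k, ((V k).conjTranspose * V k * X + X * ((V k).conjTranspose * V k)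
    - (2 : ℝ) • (V k * X * (V k).conjTranspose))
  map_add' X Z := by
    rw [← smul_add, ← Finset.sum_add_distrib]
    congr 1
    refine Finset.sum_congr rfl fun k _ => ?_
    simp only [mul_add, add_mul, smul_add]
    abel
  map_smul' s X := by
    rw [RingHom.id_apply, smul_comm s (1 / 2 : ℝ), Finset.smul_sum (r := s)]
    congr 1
    refine Finset.sum_congr rfl fun k _ => ?_
    simp only [Matrix.mul_smul, Matrix.smul_mul, smul_add, smul_sub, smul_comm s]

/-- The restriction of `Γ_L` to `𝔥𝔢𝔯₀(N)`. -/
def lindbladOp {r : ℕ} (V : Fin r → Matrix (Fin N) (Fin N) ℂ) : SuperOp N :=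
  restrictHer0 (lindbladTerm V) fun X hX _ => by
    refine ⟨?_, ?_⟩
    · simp only [lindbladTerm, LinearMap.coe_mk, AddHom.coe_mk, Matrix.conjTranspose_smul,
        Matrix.conjTranspose_sum, star_trivial]
      congr 1
      refine Finset.sum_congr rfl fun k _ => ?_
      simp only [Matrix.conjTranspose_sub, Matrix.conjTranspose_add, Matrix.conjTranspose_smul,
        Matrix.conjTranspose_mul, Matrix.conjTranspose_conjTranspose, hX, star_trivial, mul_assoc]
      abel
    · simp only [lindbladTerm, LinearMap.coe_mk, AddHom.coe_mk, Matrix.trace_smul,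
        Matrix.trace_sum, Matrix.trace_sub, Matrix.trace_add]
      rw [Finset.sum_eq_zero, smul_zero]
      intro k _
      rw [Matrix.trace_mul_comm X, Matrix.trace_mul_comm (V k * X), ← mul_assoc, two_smul, sub_self]

/-- The controlled Hamiltonian `H_u = H_d + ∑ⱼ uⱼ Hⱼ`. -/
def hamiltonian {m : ℕ} (Hd : Her0 N) (H : Fin m → Her0 N) (u : Fin m → ℝ) : Her0 N :=
  Hd + ∑ j, u j • H j

/-- `ℒ_u = i ad_{H_u} + Γ_L` on `𝔥𝔢𝔯₀(N)`; the (homogeneous) master equation is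
`ρ' = -ℒ_u ρ`. -/
def liouvillian {m r : ℕ} (Hd : Her0 N) (H : Fin m → Her0 N)
    (V : Fin r → Matrix (Fin N) (Fin N) ℂ) (u : Fin m → ℝ) : SuperOp N :=
  adOp (Complex.I • Her0.toMatrix (hamiltonian Hd H u))
    (by simp [Matrix.conjTranspose_smul, Her0.conjTranspose_coe]) + lindbladOp V

/-- The system semigroup `P_Σ ⊆ GL(𝔥𝔢𝔯₀(N))`, generated by the one-parameter semigroups
`T_u(t) = exp (-t ℒ_u)`, `t ≥ 0`, of all constant controls `u ∈ ℝᵐ`. -/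
def systemSemigroup {m r : ℕ} (Hd : Her0 N) (H : Fin m → Her0 N)
    (V : Fin r → Matrix (Fin N) (Fin N) ℂ) : Submonoid (SuperOp N)ˣ :=
  Submonoid.closure {T | ∃ (u : Fin m → ℝ) (t : ℝ), 0 ≤ t ∧
    T = expUnit (-(t • liouvillian Hd H V u))}

/-- The set `exp(-𝔠) · Ad_{SU(N)}`. -/
def expConeAdSU (c : Set (SuperOp N)) : Set (SuperOp N)ˣ :=
  {T | ∃ C ∈ c, ∃ U : Matrix.specialUnitaryGroup (Fin N) ℂ, T = expUnit (-C) * AdSU N U}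

end

noncomputable section

/-! ### Exponentials, Duhamel's formula and tangent cones in a Banach algebra. -/

section BanachAlgebra

open NormedSpace Filter

/-! Write `𝔨` for `adSu N` and `K` for the range of `AdSU N`. The heart of the matter is that
`exp(-c) K` is closed under products. Since `K` normalizes `c`, it suffices to write `exp(-C)
exp(-D)` with `C, D ∈ c` as `exp(-Z) k`. The cone part of this polar decomposition must stay in `c`,
and this is shown by a viability argument along `t ↦ exp(-C) exp(-tD)`: a curve starting in a closed
set cannot leave it if its distance to the set grows at rate at most zero
(`exp_neg_mul_exp_neg_mem_gradedCone`). Two facts give the rate. Right multiplication by `exp(-tD)`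
and by `K` is contractive, so the curve may be compared with the one issuing from a nearest point
`exp(-X) k`. There `exp(-X) exp(-tD)` agrees to first order with `exp(-tW) exp(-(X+tD)) exp(-tW')`
for suitable `W, W' ∈ 𝔨` (`exists_skew_infinitesimal`), where `X + tD` is visibly in the cone. The
commutator hypotheses enter only here: they make `span c ⊕ 𝔨` invariant under `ad X`, and Duhamel's
formula reduces the claim to a solvable linear equation.

Closedness in `GL` follows from `‖X‖ ≤ ‖exp X - 1‖` for positive `X` and compactness of `K`
(`isClosed_submonoid`). For the Lie wedge, a curve `f = exp(-X) k` satisfies `f f* = exp(-2X)`,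
which isolates the velocity of `X`, a limit in `c`; the remaining velocity, that of `k`, is a
derivation of the matrix algebra, hence inner (`exists_of_mem_tangentCone`, `mem_adSu_of_tendsto`).
As every element of `K` is an exponential (`exists_expUnit_eq_AdSU`), `exp(-c) K` is a Lie
subsemigroup. It contains the generators `exp(-tℒ_u)` because a closed semigroup contains the
exponentials of its tangent vectors (`expUnit_mem_of_mem_tangentCone`). That the system semigroup
has a Lie closure is general: it is generated by rays. -/

theorem norm_pow_le_of_norm_one_le {B : Type*} [NormedRing B] (h1 : ‖(1 : B)‖ ≤ 1) {a : B} {M : ℝ}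
    (ha : ‖a‖ ≤ M) (n : ℕ) :
    ‖a ^ n‖ ≤ M ^ n := by
  induction n with
  | zero => simpa
  | succ n ih =>
    rw [pow_succ, pow_succ]
    exact (norm_mul_le _ _).trans
      (mul_le_mul ih ha (norm_nonneg _) ((norm_nonneg _).trans ih))

/-- Telescoping. The bound on `‖1‖` is an inequality because operators on the zero space (`N ≤ 1`)
have `‖1‖ = 0`. -/
theorem norm_pow_sub_pow_le {B : Type*} [NormedRing B] (h1 : ‖(1 : B)‖ ≤ 1) {a b : B} {M : ℝ}
    (hM : 1 ≤ M) (ha : ‖a‖ ≤ M) (hb : ‖b‖ ≤ M) (n : ℕ) : ‖a ^ n - b ^ n‖ ≤ n * M ^ n * ‖a - b‖ := by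
  induction n with
  | zero => simp
  | succ n ih =>
    have e : a ^ (n + 1) - b ^ (n + 1) = a ^ n * (a - b) + (a ^ n - b ^ n) * b := by
      rw [pow_succ, pow_succ]; noncomm_ring
    have h2 : ‖a ^ n * (a - b)‖ ≤ M ^ (n + 1) * ‖a - b‖ := by
      refine (norm_mul_le _ _).trans (mul_le_mul_of_nonneg_right ?_ (norm_nonneg _))
      exact (norm_pow_le_of_norm_one_le h1 ha n).trans (pow_le_pow_right₀ hM n.le_succ)
    have h3 : ‖(a ^ n - b ^ n) * b‖ ≤ n * M ^ n * ‖a - b‖ * M := by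
      refine (norm_mul_le _ _).trans (mul_le_mul ih hb (norm_nonneg _) ?_)
      positivity
    rw [e]
    refine (norm_add_le _ _).trans ((add_le_add h2 h3).trans (le_of_eq ?_))
    push_cast; ring

/-- Left minus right multiplication by `x`. -/
def adL {B : Type*} [NormedRing B] [NormedAlgebra ℝ B] (x : B) : B →L[ℝ] B :=
  ContinuousLinearMap.mul ℝ B x - (ContinuousLinearMap.mul ℝ B).flip x

@[simp] theorem adL_apply {B : Type*} [NormedRing B] [NormedAlgebra ℝ B] (x z : B) :
    adL x z = x * z - z * x := by simp [adL]

variable {A : Type*} [NormedRing A] [NormedAlgebra ℝ A] [CompleteSpace A]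

theorem continuous_exp_of_real : Continuous (exp : A → A) := by
  let _ : NormedAlgebra ℚ A := NormedAlgebra.restrictScalars ℚ ℝ A
  exact exp_continuous

theorem exp_add_of_commute_of_real {x y : A} (h : Commute x y) :
    exp (x + y) = exp x * exp y := by
  let _ : NormedAlgebra ℚ A := NormedAlgebra.restrictScalars ℚ ℝ A
  exact exp_add_of_commute h

theorem exp_mul_exp_neg (x : A) : exp x * exp (-x) = 1 := (expUnit x).val_inv

theorem exp_neg_mul_exp (x : A) : exp (-x) * exp x = 1 := (expUnit x).inv_val

theorem val_expUnit (x : A) : (expUnit x : A) = exp x := rfl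

theorem val_inv_expUnit (x : A) : ((expUnit x)⁻¹ : Aˣ).val = exp (-x) := rfl

theorem inv_expUnit (x : A) : (expUnit x)⁻¹ = expUnit (-x) := by
  ext; rfl

theorem expUnit_zero : expUnit (0 : A) = 1 := by
  ext; exact exp_zero

theorem exp_conj_unit (y : Aˣ) (x : A) : exp (y * x * (y⁻¹ : Aˣ)) = y * exp x * (y⁻¹ : Aˣ) := by
  let _ : NormedAlgebra ℚ A := NormedAlgebra.restrictScalars ℚ ℝ A
  exact exp_units_conj y x

theorem expUnit_conj (y : Aˣ) (x : A) :
    expUnit (y * x * (y⁻¹ : Aˣ)) = y * expUnit x * y⁻¹ := by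
  ext; exact exp_conj_unit y x

theorem hasSum_exp_of_real (x : A) : HasSum (fun n : ℕ => ((n.factorial : ℝ)⁻¹) • x ^ n) (exp x) :=
  exp_series_hasSum_exp' x

/-- Operators intertwined by a continuous linear map have intertwined exponentials. -/
theorem apply_exp_of_intertwine {V W : Type*} [NormedAddCommGroup V] [NormedSpace ℝ V]
    [CompleteSpace V] [NormedAddCommGroup W] [NormedSpace ℝ W] [CompleteSpace W]
    (T : V →L[ℝ] W) (a : V →L[ℝ] V) (b : W →L[ℝ] W) (h : ∀ v, T (a v) = b (T v)) (v : V) :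
    T (exp a v) = exp b (T v) := by
  have hn : ∀ (n : ℕ) (v : V), T ((a ^ n) v) = (b ^ n) (T v) := by
    intro n
    induction n with
    | zero => intro v; simp
    | succ n ih => intro v; rw [pow_succ, pow_succ, mul_apply_eq_comp,
        mul_apply_eq_comp, ih, h]
  have h1 := ((hasSum_exp_of_real a).mapL (ContinuousLinearMap.apply ℝ V v)).mapL T
  have h2 := (hasSum_exp_of_real b).mapL (ContinuousLinearMap.apply ℝ W (T v))
  refine h1.unique (h2.congr_fun fun n => ?_)
  change T (((n.factorial : ℝ)⁻¹ • a ^ n) v) = ((n.factorial : ℝ)⁻¹ • b ^ n) (T v)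
  rw [smul_apply, smul_apply, map_smul, hn]

theorem exp_apply_mem_of_invariant {V : Type*} [NormedAddCommGroup V] [NormedSpace ℝ V]
    [CompleteSpace V] (a : V →L[ℝ] V) (M : Submodule ℝ V) (hM : IsClosed (M : Set V))
    (h : ∀ v ∈ M, a v ∈ M) {v : V} (hv : v ∈ M) : exp a v ∈ M := by
  have hn : ∀ n : ℕ, (a ^ n) v ∈ M := by
    intro n
    induction n with
    | zero => simpa
    | succ n ih => rw [pow_succ']; exact h _ ih
  have h1 := (hasSum_exp_of_real a).mapL (ContinuousLinearMap.apply ℝ V v)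
  refine hM.mem_of_tendsto h1 (Eventually.of_forall fun s => ?_)
  refine M.sum_mem fun n _ => ?_
  exact M.smul_mem _ (hn n)

/-- Left and right multiplications commute, so the exponential of their difference factors. -/
theorem exp_adL_apply (x z : A) : exp (adL x) z = exp x * z * exp (-x) := by
  let _ : NormedAlgebra ℚ A := NormedAlgebra.restrictScalars ℚ ℝ A
  let _ : NormedAlgebra ℚ (A →L[ℝ] A) := NormedAlgebra.restrictScalars ℚ ℝ (A →L[ℝ] A)
  have hc : Commute (ContinuousLinearMap.mul ℝ A x)
      (-(ContinuousLinearMap.mul ℝ A).flip x) := by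
    ext z; simp [mul_assoc]
  have hl : exp (ContinuousLinearMap.mul ℝ A x) = ContinuousLinearMap.mul ℝ A (exp x) := by
    have h1 := hasSum_exp_of_real (ContinuousLinearMap.mul ℝ A x)
    have h2 := (hasSum_exp_of_real x).mapL (ContinuousLinearMap.mul ℝ A)
    refine h1.unique (h2.congr_fun fun n => ?_)
    rw [map_smul]
    congr 1
    induction n with
    | zero => ext; simp
    | succ n ih => rw [pow_succ, ih, pow_succ]; ext; simp [mul_assoc]
  have hr : exp (-(ContinuousLinearMap.mul ℝ A).flip x) =
      (ContinuousLinearMap.mul ℝ A).flip (exp (-x)) := by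
    have h1 := hasSum_exp_of_real (-(ContinuousLinearMap.mul ℝ A).flip x)
    have h2 := (hasSum_exp_of_real (-x)).mapL (ContinuousLinearMap.mul ℝ A).flip
    refine h1.unique (h2.congr_fun fun n => ?_)
    rw [map_smul]
    congr 1
    induction n with
    | zero => ext; simp
    | succ n ih => rw [pow_succ, ih, pow_succ']; ext; simp [mul_assoc]
  rw [adL, sub_eq_add_neg, exp_add_of_commute hc, hl, hr]
  simp [mul_assoc]

theorem hasDerivAt_exp_smul_zero (x : A) : HasDerivAt (fun s : ℝ => exp (s • x)) x 0 := by
  simpa using hasDerivAt_exp_smul_const x (0 : ℝ)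

theorem hasDerivAt_exp_neg_smul_zero (x : A) :
    HasDerivAt (fun s : ℝ => exp (-(s • x))) (-x) 0 := by
  simpa using hasDerivAt_exp_smul_zero (-x)

theorem hasDerivAt_exp_smul_conj (x z : A) (t : ℝ) :
    HasDerivAt (fun s : ℝ => exp (s • x) * z * exp (-(s • x)))
      (exp (t • x) * (x * z - z * x) * exp (-(t • x))) t := by
  have h1 := hasDerivAt_exp_smul_const x t
  have h2 := hasDerivAt_exp_smul_const' (-x) t
  simp only [smul_neg] at h2
  refine ((h1.mul_const z).mul h2).congr_deriv ?_
  noncomm_ring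

theorem contDiff_exp_smul (x : A) : ContDiff ℝ ∞ (fun s : ℝ => exp (s • x)) := by
  have h : ContDiff ℝ ∞ (exp : A → A) :=
    contDiff_iff_contDiffAt.2 fun y => (exp_analytic (𝕂 := ℝ) y).contDiffAt
  exact h.comp (contDiff_id.smul contDiff_const)

/-- Duhamel's formula for the derivative of the exponential. -/
theorem hasDerivAt_exp_mul_exp_neg_add (x d : A) :
    HasDerivAt (fun h : ℝ => exp x * exp (-(x + h • d)))
      (-∫ s in (0 : ℝ)..1, exp (s • x) * d * exp (-(s • x))) 0 := by
  have hexp := continuous_exp_of_real (A := A)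
  set F : ℝ → A := fun h => ∫ s in (0 : ℝ)..1, exp (s • x) * d * exp (-(s • (x + h • d)))
    with hF
  -- Fundamental theorem of calculus for `s ↦ exp(sx) exp(-s(x+hd))` on `[0,1]`. The factor `h`
  -- comes out explicitly, so continuity of `F` at `0` is enough to differentiate.
  have key : ∀ h : ℝ, exp x * exp (-(x + h • d)) = 1 - h • F h := by
    intro h
    have hder : ∀ s ∈ uIcc (0 : ℝ) 1, HasDerivAt
        (fun s : ℝ => exp (s • x) * exp (-(s • (x + h • d))))
        (-(h • (exp (s • x) * d * exp (-(s • (x + h • d)))))) s := by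
      intro s _
      have h1 := hasDerivAt_exp_smul_const x s
      have h2 := hasDerivAt_exp_smul_const' (-(x + h • d)) s
      simp only [smul_neg] at h2
      refine (h1.mul h2).congr_deriv ?_
      rw [← smul_mul_assoc, ← mul_smul_comm]
      noncomm_ring
    have := intervalIntegral.integral_eq_sub_of_hasDerivAt hder
      (Continuous.intervalIntegrable (by fun_prop) _ _)
    rw [intervalIntegral.integral_neg, intervalIntegral.integral_smul] at this
    simp only [one_smul, zero_smul, neg_zero, exp_zero, mul_one] at this
    rw [sub_eq_add_neg]
    exact (add_eq_of_eq_sub' this).symm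
  have hcont : Continuous F :=
    intervalIntegral.continuous_parametric_intervalIntegral_of_continuous' (by fun_prop) 0 1
  have h0 : ∫ s in (0 : ℝ)..1, exp (s • x) * d * exp (-(s • x)) = F 0 := by simp [hF]
  rw [h0]
  simp only [key]
  have h1 : HasDerivAt (fun h : ℝ => h • F h) (F 0) 0 := by
    rw [hasDerivAt_iff_tendsto_slope]
    refine (hcont.continuousAt.tendsto.mono_left nhdsWithin_le_nhds).congr' ?_
    filter_upwards [self_mem_nhdsWithin] with h hh
    have : h ≠ 0 := hh
    simp [slope_def_module, smul_smul, this]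
  simpa using h1.const_sub 1

theorem integral_unitInterval_mem (M : Submodule ℝ A) (hM : IsClosed (M : Set A)) {f : ℝ → A}
    (hf : Continuous f) (h : ∀ s, f s ∈ M) : ∫ s in (0 : ℝ)..1, f s ∈ M := by
  rw [intervalIntegral.integral_of_le zero_le_one]
  have : MeasureTheory.IsProbabilityMeasure
      (MeasureTheory.volume.restrict (Ioc (0 : ℝ) 1)) := ⟨by simp⟩
  refine M.convex.integral_mem hM (Eventually.of_forall h) ?_
  exact (hf.integrableOn_Icc (a := 0) (b := 1)).mono_set Ioc_subset_Icc_self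

/-- A curve through `1` with velocity `g` approximates `exp g` by its powers. -/
theorem tendsto_pow_exp_of_hasDerivWithinAt (h1 : ‖(1 : A)‖ ≤ 1) {f : ℝ → A} {g : A} (h0 : f 0 = 1)
    (hf : HasDerivWithinAt f g (Ici 0) 0) :
    Tendsto (fun n : ℕ => f ((n : ℝ)⁻¹) ^ n) atTop (𝓝 (exp g)) := by
  let _ : NormedAlgebra ℚ A := NormedAlgebra.restrictScalars ℚ ℝ A
  have hinv : Tendsto (fun n : ℕ => (n : ℝ)⁻¹) atTop (𝓝[>] 0) :=
    tendsto_nhdsWithin_iff.2 ⟨tendsto_inv_atTop_nhds_zero_nat,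
      (eventually_gt_atTop 0).mono fun n hn => by simpa using hn⟩
  have hlim : ∀ {f : ℝ → A}, f 0 = 1 → HasDerivWithinAt f g (Ici 0) 0 →
      Tendsto (fun n : ℕ => (n : ℝ) • (f ((n : ℝ)⁻¹) - 1)) atTop (𝓝 g) := by
    intro f h0 hf
    have := (hasDerivWithinAt_iff_tendsto_slope.1 hf)
    rw [Ici_sdiff_left] at this
    refine (this.comp hinv).congr fun n => ?_
    simp [slope_def_module, h0]
  have hE : HasDerivWithinAt (fun s : ℝ => exp (s • g)) g (Ici 0) 0 :=
    (hasDerivAt_exp_smul_zero g).hasDerivWithinAt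
  -- The bound is chosen so that its `n`-th power is `exp(‖g‖ + 1)`, independent of `n`.
  have hbd : ∀ {f : ℝ → A}, f 0 = 1 → HasDerivWithinAt f g (Ici 0) 0 →
      ∀ᶠ n : ℕ in atTop, ‖f ((n : ℝ)⁻¹)‖ ≤ Real.exp ((‖g‖ + 1) / n) := by
    intro f h0 hf
    filter_upwards [(hlim h0 hf).norm.eventually (gt_mem_nhds (lt_add_one ‖g‖)),
      eventually_gt_atTop 0] with n hn hn0
    have hn0' : (0 : ℝ) < n := by exact_mod_cast hn0
    rw [norm_smul, Real.norm_natCast] at hn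
    have h2 : ‖f ((n : ℝ)⁻¹) - 1‖ ≤ (‖g‖ + 1) / n := by
      rw [le_div_iff₀ hn0']; linarith
    have h3 := norm_add_le (f ((n : ℝ)⁻¹) - 1) 1
    rw [sub_add_cancel] at h3
    have h4 := Real.add_one_le_exp ((‖g‖ + 1) / n)
    linarith
  have hz : exp ((0 : ℝ) • g) = 1 := by simp
  have hdiff : Tendsto (fun n : ℕ => Real.exp (‖g‖ + 1) *
      ‖(n : ℝ) • (f ((n : ℝ)⁻¹) - 1) - (n : ℝ) • (exp ((n : ℝ)⁻¹ • g) - 1)‖) atTop (𝓝 0) := by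
    have := ((hlim h0 hf).sub (hlim hz hE)).norm.const_mul (Real.exp (‖g‖ + 1))
    simpa using this
  have hsub : Tendsto (fun n : ℕ => f ((n : ℝ)⁻¹) ^ n - exp g) atTop (𝓝 0) := by
    refine squeeze_zero_norm' ?_ hdiff
    filter_upwards [hbd h0 hf, hbd hz hE, eventually_gt_atTop 0] with n ha hb hn0
    have hn0' : (0 : ℝ) < n := by exact_mod_cast hn0
    have hpow : exp ((n : ℝ)⁻¹ • g) ^ n = exp g := by
      rw [← exp_nsmul, ← Nat.cast_smul_eq_nsmul ℝ, smul_smul, mul_inv_cancel₀ hn0'.ne', one_smul]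
    have hM : (1 : ℝ) ≤ Real.exp ((‖g‖ + 1) / n) := Real.one_le_exp (by positivity)
    have h := norm_pow_sub_pow_le h1 hM ha hb n
    have hMn : Real.exp ((‖g‖ + 1) / n) ^ n = Real.exp (‖g‖ + 1) := by
      rw [← Real.exp_nat_mul]; congr 1; field_simp
    rw [hpow, hMn] at h
    refine h.trans (le_of_eq ?_)
    rw [← smul_sub, norm_smul, Real.norm_natCast, sub_sub_sub_cancel_right]
    ring
  simpa using hsub.add_const (exp g)

theorem tendsto_units_of_val {B ι : Type*} [NormedRing B] [CompleteSpace B] {l : Filter ι}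
    {u : ι → Bˣ} {v : Bˣ} (h : Tendsto (fun i => (u i : B)) l (𝓝 v)) : Tendsto u l (𝓝 v) :=
  (Units.isOpenEmbedding_val (R := B)).toIsEmbedding.tendsto_nhds_iff.2 h

/-- The exponentials of the tangent vectors of a closed subsemigroup lie in it. -/
theorem expUnit_mem_of_mem_tangentCone (h1 : ‖(1 : A)‖ ≤ 1) {S : Submonoid Aˣ}
    (hS : IsClosed (S : Set Aˣ)) {g : A} (hg : g ∈ tangentCone (S : Set Aˣ)) :
    expUnit g ∈ S := by
  obtain ⟨γ, -, h0, hmem, hder⟩ := hg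
  have h := tendsto_pow_exp_of_hasDerivWithinAt h1 (f := fun t => (γ t : A)) (by simp [h0]) hder
  refine hS.mem_of_tendsto (f := fun n : ℕ => γ ((n : ℝ)⁻¹) ^ n) (b := atTop)
    (tendsto_units_of_val ?_) (Eventually.of_forall fun n => ?_)
  · simpa [val_expUnit] using h
  · exact S.pow_mem (hmem _ (by positivity)) n

theorem mem_tangentCone_of_expUnit_mem {S : Set Aˣ} {g : A}
    (h : ∀ t : ℝ, 0 ≤ t → expUnit (t • g) ∈ S) : g ∈ tangentCone S :=
  ⟨fun t => expUnit (t • g), (contDiff_exp_smul g).contDiffOn, by simp [expUnit_zero], h,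
    (hasDerivAt_exp_smul_zero g).hasDerivWithinAt⟩

/-- A closed subsemigroup which is topologically generated by exponentials of its tangent
vectors is a Lie subsemigroup. -/
theorem isLieSubsemigroup_of_subset_closure (h1 : ‖(1 : A)‖ ≤ 1) {S : Submonoid Aˣ}
    (hS : IsClosed (S : Set Aˣ))
    (h : (S : Set Aˣ) ⊆ closure (Submonoid.closure (expUnit '' tangentCone (S : Set Aˣ)) : Set Aˣ)) :
    IsLieSubsemigroup (S : Set Aˣ) where
  one_mem := S.one_mem
  mul_mem _ hx _ hy := S.mul_mem hx hy
  isClosed := hS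
  eq_closure := by
    refine h.antisymm (closure_minimal ?_ hS)
    rw [SetLike.coe_subset_coe, Submonoid.closure_le]
    rintro _ ⟨g, hg, rfl⟩
    exact expUnit_mem_of_mem_tangentCone h1 hS hg

/-- The closed semigroup generated by one-parameter semigroups is a Lie subsemigroup. -/
theorem isLieSubsemigroup_closure_of_generators (h1 : ‖(1 : A)‖ ≤ 1) {ι : Type*} (x : ι → A) :
    IsLieSubsemigroup (closure (Submonoid.closure
      {T : Aˣ | ∃ (i : ι) (t : ℝ), 0 ≤ t ∧ T = expUnit (-(t • x i))} : Set Aˣ)) := by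
  set P : Submonoid Aˣ := Submonoid.closure
    {T : Aˣ | ∃ (i : ι) (t : ℝ), 0 ≤ t ∧ T = expUnit (-(t • x i))} with hP
  refine isLieSubsemigroup_of_subset_closure (S := P.topologicalClosure) h1
    P.isClosed_topologicalClosure (closure_mono ?_)
  rw [SetLike.coe_subset_coe, hP, Submonoid.closure_le]
  rintro _ ⟨u, t, ht, rfl⟩
  refine Submonoid.subset_closure ⟨_, mem_tangentCone_of_expUnit_mem fun s hs => ?_, rfl⟩
  refine subset_closure (Submonoid.subset_closure ⟨u, s * t, mul_nonneg hs ht, ?_⟩)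
  rw [smul_neg, smul_smul]

end BanachAlgebra

/-! ### Norm estimates for exponentials of positive operators. -/

section Positive

open NormedSpace Filter
open scoped InnerProductSpace

variable {E : Type*} [NormedAddCommGroup E] [InnerProductSpace ℝ E]

/-- Induction in steps of two: by symmetry `⟪C^(n+2) v, v⟫ = ⟪C^n (C v), C v⟫`. -/
theorem inner_pow_apply_nonneg {C : E →L[ℝ] E} (hC : C.IsPositive) :
    ∀ (n : ℕ) (v : E), 0 ≤ ⟪(C ^ n) v, v⟫_ℝ
  | 0, v => by simp
  | 1, v => by simpa using hC.inner_nonneg_left v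
  | n + 2, v => by
    have h := inner_pow_apply_nonneg hC n (C v)
    rwa [← hC.inner_left_eq_inner_right, ← mul_apply_eq_comp, ← mul_apply_eq_comp,
      ← pow_succ', ← pow_succ] at h

variable [CompleteSpace E]

theorem hasSum_inner_exp_apply (C : E →L[ℝ] E) (v w : E) :
    HasSum (fun n : ℕ => (n.factorial : ℝ)⁻¹ * ⟪(C ^ n) v, w⟫_ℝ) ⟪exp C v, w⟫_ℝ := by
  have h := ((hasSum_exp_of_real C).mapL (ContinuousLinearMap.apply ℝ E v)).mapL
    (innerSL ℝ w)
  have e : ⟪exp C v, w⟫_ℝ = innerSL ℝ w (ContinuousLinearMap.apply ℝ E v (exp C)) := by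
    simp [real_inner_comm]
  rw [e]
  refine h.congr_fun fun n => ?_
  change _ = ⟪w, ((n.factorial : ℝ)⁻¹ • C ^ n) v⟫_ℝ
  rw [smul_apply, real_inner_smul_right, real_inner_comm]

/-- All terms of the series for `⟪exp C v, v⟫` are nonnegative; keep the zeroth and apply
Cauchy–Schwarz. -/
theorem norm_le_norm_exp_apply {C : E →L[ℝ] E} (hC : C.IsPositive) (v : E) :
    ‖v‖ ≤ ‖exp C v‖ := by
  have h := sum_le_hasSum (Finset.range 1) (fun n _ => mul_nonneg (by positivity)
    (inner_pow_apply_nonneg hC n v)) (hasSum_inner_exp_apply C v v)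
  simp only [Finset.range_one, Finset.sum_singleton, Nat.factorial_zero, Nat.cast_one, inv_one,
    pow_zero, one_apply_eq_self, one_mul] at h
  have h2 := h.trans (real_inner_le_norm _ _)
  rw [real_inner_self_eq_norm_mul_norm] at h2
  rcases (norm_nonneg v).eq_or_lt with h0 | h0
  · rw [← h0]; positivity
  · exact le_of_mul_le_mul_right h2 h0

/-- Same argument, pairing with `C v` and keeping the first two terms. It gives control of `C` by
`exp C`, which is the source of the compactness arguments below. -/
theorem norm_apply_le_norm_exp_sub_one_apply {C : E →L[ℝ] E} (hC : C.IsPositive) (v : E) :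
    ‖C v‖ ≤ ‖(exp C - 1) v‖ := by
  have hn : ∀ n : ℕ, 0 ≤ ⟪(C ^ n) v, C v⟫_ℝ := fun n => by
    rw [← hC.inner_left_eq_inner_right, ← mul_apply_eq_comp, ← pow_succ']
    exact inner_pow_apply_nonneg hC (n + 1) v
  have h := sum_le_hasSum (Finset.range 2) (fun n _ => mul_nonneg (by positivity) (hn n))
    (hasSum_inner_exp_apply C v (C v))
  simp only [Finset.sum_range_succ, Finset.range_zero, Finset.sum_empty, Nat.factorial_zero,
    Nat.cast_one, inv_one, pow_zero, one_apply_eq_self, one_mul, zero_add, Nat.factorial_one,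
    pow_one] at h
  have h2 : ⟪C v, C v⟫_ℝ ≤ ⟪(exp C - 1) v, C v⟫_ℝ := by
    rw [sub_apply, inner_sub_left, one_apply_eq_self]; linarith
  replace h2 := h2.trans (real_inner_le_norm _ _)
  rw [real_inner_self_eq_norm_mul_norm] at h2
  rcases (norm_nonneg (C v)).eq_or_lt with h0 | h0
  · rw [← h0]; positivity
  · exact le_of_mul_le_mul_right h2 h0

theorem norm_le_norm_exp_sub_one {C : E →L[ℝ] E} (hC : C.IsPositive) : ‖C‖ ≤ ‖exp C - 1‖ :=
  C.opNorm_le_bound (norm_nonneg _) fun v =>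
    (norm_apply_le_norm_exp_sub_one_apply hC v).trans ((exp C - 1).le_opNorm v)

theorem norm_exp_neg_le_one {C : E →L[ℝ] E} (hC : C.IsPositive) : ‖exp (-C)‖ ≤ 1 := by
  refine ContinuousLinearMap.opNorm_le_bound _ zero_le_one fun v => ?_
  have h := norm_le_norm_exp_apply hC (exp (-C) v)
  rwa [← mul_apply_eq_comp, exp_mul_exp_neg, one_apply_eq_self, ← one_mul ‖v‖] at h

end Positive

/-! ### The Hilbert–Schmidt inner product and a symmetric linear equation. -/

section HilbertSchmidt

open NormedSpace Filter
open scoped InnerProductSpace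

/-- A symmetric operator exchanging `𝔨` and `𝔭` maps `𝔨` onto the orthogonal complement, within
`𝔭`, of its kernel. The inner product is the one induced by an embedding `J`. -/
theorem exists_apply_eq_of_orthogonal_ker {V H : Type*} [AddCommGroup V] [Module ℝ V]
    [NormedAddCommGroup H] [InnerProductSpace ℝ H] [FiniteDimensional ℝ H] (J : V →ₗ[ℝ] H)
    (hJ : Function.Injective J) (T : V →ₗ[ℝ] V)
    (hT : ∀ x y, ⟪J (T x), J y⟫_ℝ = ⟪J x, J (T y)⟫_ℝ) {𝔨 𝔭 : Submodule ℝ V}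
    (hkp : ∀ w ∈ 𝔨, T w ∈ 𝔭) (hpk : ∀ z ∈ 𝔭, T z ∈ 𝔨) {R : V} (hR : R ∈ 𝔭)
    (horth : ∀ z ∈ 𝔭, T z = 0 → ⟪J R, J z⟫_ℝ = 0) : ∃ W ∈ 𝔨, T W = R := by
  set M : Submodule ℝ H := 𝔨.map (J ∘ₗ T) with hM
  obtain ⟨W, hW, hW'⟩ : ∃ W ∈ 𝔨, J (T W) = M.starProjection (J R) :=
    M.starProjection_apply_mem (J R)
  refine ⟨W, hW, ?_⟩
  -- The residual `q` is orthogonal to `T 𝔨`. Since `T q ∈ 𝔨`, symmetry gives `‖T q‖² = ⟪q, T (T q)⟫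
  -- = 0`; then `q` lies in the kernel, to which both `R` and `T W` are orthogonal.
  set q := R - T W with hq
  have hqp : q ∈ 𝔭 := 𝔭.sub_mem hR (hkp W hW)
  have hqo : ∀ w ∈ 𝔨, ⟪J q, J (T w)⟫_ℝ = 0 := by
    intro w hw
    rw [hq, map_sub, hW']
    exact M.starProjection_inner_eq_zero (J R) _ ⟨w, hw, rfl⟩
  have hTq : T q = 0 := by
    have h := hqo _ (hpk q hqp)
    rw [← hT, inner_self_eq_zero] at h
    exact hJ (by rw [h, map_zero])
  have h1 := horth q hqp hTq
  have h2 : ⟪J q, J q⟫_ℝ = 0 := by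
    have e : ⟪J q, J q⟫_ℝ = ⟪J R, J q⟫_ℝ - ⟪J (T W), J q⟫_ℝ := by
      rw [← inner_sub_left, ← map_sub]
    rw [e, h1, hT, hTq]; simp
  rw [inner_self_eq_zero] at h2
  have h3 : q = 0 := hJ (by rw [h2, map_zero])
  exact (sub_eq_zero.1 h3).symm

variable {E : Type*} [NormedAddCommGroup E] [InnerProductSpace ℝ E] [FiniteDimensional ℝ E]

/-- The columns of an operator with respect to an orthonormal basis. -/
def hsEmbed : (E →L[ℝ] E) →ₗ[ℝ] PiLp 2 (fun _ : Fin (Module.finrank ℝ E) => E) where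
  toFun S := WithLp.toLp 2 fun i => S (stdOrthonormalBasis ℝ E i)
  map_add' S T := by ext; simp
  map_smul' r S := by ext; simp

theorem hsEmbed_injective : Function.Injective (hsEmbed (E := E)) := by
  intro S T h
  refine ContinuousLinearMap.coe_injective ((stdOrthonormalBasis ℝ E).toBasis.ext fun i => ?_)
  have := congrArg (fun x => x i) h
  simpa [hsEmbed] using this

/-- The Hilbert-Schmidt inner product of operators. -/
def hsInner (S T : E →L[ℝ] E) : ℝ := ⟪hsEmbed S, hsEmbed T⟫_ℝ

theorem hsInner_eq_trace (S T : E →L[ℝ] E) :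
    hsInner S T = LinearMap.trace ℝ E (star S * T : E →L[ℝ] E) := by
  rw [LinearMap.trace_eq_sum_inner _ (stdOrthonormalBasis ℝ E), hsInner, PiLp.inner_apply]
  refine Finset.sum_congr rfl fun i _ => ?_
  simp [hsEmbed, ContinuousLinearMap.star_eq_adjoint, ContinuousLinearMap.adjoint_inner_right]

theorem trace_mul_comm_clm {F : Type*} [NormedAddCommGroup F] [NormedSpace ℝ F] (S T : F →L[ℝ] F) :
    LinearMap.trace ℝ F (S * T : F →L[ℝ] F) = LinearMap.trace ℝ F (T * S : F →L[ℝ] F) :=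
  LinearMap.trace_mul_comm ℝ (S : F →ₗ[ℝ] F) (T : F →ₗ[ℝ] F)

theorem hsInner_comm (S T : E →L[ℝ] E) : hsInner S T = hsInner T S := real_inner_comm _ _

theorem hsInner_star_star (S T : E →L[ℝ] E) : hsInner (star S) (star T) = hsInner S T := by
  rw [hsInner_comm S T, hsInner_eq_trace, hsInner_eq_trace, star_star, trace_mul_comm_clm]

theorem hsInner_conj_left {P Q : E →L[ℝ] E} (hP : star P = P) (hQ : star Q = Q)
    (S T : E →L[ℝ] E) : hsInner (P * S * Q) T = hsInner S (P * T * Q) := by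
  rw [hsInner_eq_trace, hsInner_eq_trace, star_mul, star_mul, hP, hQ, mul_assoc,
    trace_mul_comm_clm]
  simp only [mul_assoc]

theorem hsInner_sub_left (S S' T : E →L[ℝ] E) :
    hsInner (S - S') T = hsInner S T - hsInner S' T := by
  simp [hsInner, inner_sub_left]

theorem hsInner_sub_right (S T T' : E →L[ℝ] E) :
    hsInner S (T - T') = hsInner S T - hsInner S T' := by
  simp [hsInner, inner_sub_right]

theorem hsInner_self_eq_zero {S : E →L[ℝ] E} : hsInner S S = 0 ↔ S = 0 := by
  rw [hsInner, inner_self_eq_zero, map_eq_zero_iff _ hsEmbed_injective]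

theorem hsInner_self_nonneg (S : E →L[ℝ] E) : 0 ≤ hsInner S S := real_inner_self_nonneg

/-- The Hilbert-Schmidt inner product as a continuous functional of its second argument. -/
def hsInnerL (S : E →L[ℝ] E) : (E →L[ℝ] E) →L[ℝ] ℝ :=
  innerSL ℝ (hsEmbed S) ∘L LinearMap.toContinuousLinearMap hsEmbed

@[simp] theorem hsInnerL_apply (S T : E →L[ℝ] E) : hsInnerL S T = hsInner S T := rfl

theorem star_exp_smul {X : E →L[ℝ] E} (hX : star X = X) (s : ℝ) :
    star (exp (s • X)) = exp (s • X) := by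
  let _ : NormedAlgebra ℚ (E →L[ℝ] E) := NormedAlgebra.restrictScalars ℚ ℝ _
  rw [star_exp, star_smul, hX, star_trivial]

theorem star_exp_neg_smul {X : E →L[ℝ] E} (hX : star X = X) (s : ℝ) :
    star (exp (-(s • X))) = exp (-(s • X)) := by
  rw [← neg_smul]; exact star_exp_smul hX _

/-- Pair the curve `exp(sX) z exp(-sX)` with `[X, z]`: the resulting function is nondecreasing and
takes equal values at `±1`, so its derivative at `0`, which is `‖[X, z]‖²`, vanishes. -/
theorem commute_of_exp_conj_eq {X z : E →L[ℝ] E} (hX : star X = X)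
    (h : exp X * z * exp (-X) = exp (-X) * z * exp X) : X * z - z * X = 0 := by
  set g : ℝ → ℝ := fun s => hsInner (X * z - z * X) (exp (s • X) * z * exp (-(s • X))) with hg
  have hder : ∀ s, HasDerivAt g (hsInner (X * z - z * X)
      (exp (s • X) * (X * z - z * X) * exp (-(s • X)))) s := fun s =>
    (hsInnerL (X * z - z * X)).hasFDerivAt.comp_hasDerivAt s (hasDerivAt_exp_smul_conj X z s)
  have hmono : Monotone g := by
    refine monotone_of_hasDerivAt_nonneg hder fun s => ?_
    have e1 : exp (s • X) = exp ((s / 2) • X) * exp ((s / 2) • X) := by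
      rw [← exp_add_of_commute_of_real (Commute.refl _), ← add_smul, add_halves]
    have e2 : exp (-(s • X)) = exp (-((s / 2) • X)) * exp (-((s / 2) • X)) := by
      rw [← exp_add_of_commute_of_real (Commute.refl _), ← neg_add, ← add_smul, add_halves]
    -- Moving half of the conjugation to the other side of the inner product turns the derivative
    -- into a squared norm.
    have e3 : exp (s • X) * (X * z - z * X) * exp (-(s • X)) = exp ((s / 2) • X) *
        (exp ((s / 2) • X) * (X * z - z * X) * exp (-((s / 2) • X))) * exp (-((s / 2) • X)) := by
      rw [e1, e2]; simp only [mul_assoc]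
    change 0 ≤ hsInner _ _
    rw [e3, ← hsInner_conj_left (star_exp_smul hX _) (star_exp_neg_smul hX _)]
    exact hsInner_self_nonneg _
  have hends : g (-1) = g 1 := by
    simp only [hg, neg_smul, one_smul, neg_neg]
    rw [h]
  have hconst : ∀ s ∈ Icc (-1 : ℝ) 1, g s = g 1 := fun s hs =>
    le_antisymm (hmono hs.2) (hends ▸ hmono hs.1)
  have hz : HasDerivAt g 0 0 := by
    refine (hasDerivAt_const (0 : ℝ) (g 1)).congr_of_eventuallyEq ?_
    filter_upwards [Icc_mem_nhds (show (-1 : ℝ) < 0 by norm_num) one_pos] with s hs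
    exact hconst s hs
  have h0 := (hder 0).unique hz
  simpa [hsInner_self_eq_zero] using h0

end HilbertSchmidt

/-! ### The infinitesimal Cartan decomposition. -/

section Infinitesimal

open NormedSpace Filter

variable {E : Type*} [NormedAddCommGroup E] [InnerProductSpace ℝ E] [FiniteDimensional ℝ E]

/-- Conjugation by `exp(sX)` is symmetric and fixes `z`, so the paired integrand is constant. -/
theorem hsInner_integral_conj_of_commute {X D z : E →L[ℝ] E} (hX : star X = X)
    (hz : X * z - z * X = 0) :
    hsInner (∫ s in (0 : ℝ)..1, exp (s • X) * D * exp (-(s • X))) z = hsInner D z := by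
  have hexp := continuous_exp_of_real (A := E →L[ℝ] E)
  have h1 : ∀ s : ℝ, hsInnerL z (exp (s • X) * D * exp (-(s • X))) = hsInner D z := by
    intro s
    have hc : Commute (exp (s • X)) z := by
      let _ : NormedAlgebra ℚ (E →L[ℝ] E) := NormedAlgebra.restrictScalars ℚ ℝ _
      exact ((show Commute X z from sub_eq_zero.1 hz).smul_left s).exp_left
    rw [hsInnerL_apply, hsInner_comm, hsInner_conj_left (star_exp_smul hX _)
      (star_exp_neg_smul hX _), hc.eq, mul_assoc, exp_mul_exp_neg, mul_one]
  rw [hsInner_comm, ← hsInnerL_apply, ← ContinuousLinearMap.intervalIntegral_comp_comm _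
    (Continuous.intervalIntegrable (by fun_prop) _ _)]
  simp [h1]

variable {𝔨 𝔭 : Submodule ℝ (E →L[ℝ] E)}

theorem eq_zero_of_eq_neg_real {V : Type*} [AddCommGroup V] [Module ℝ V] {x : V} (h : x = -x) :
    x = 0 := by
  have h2 : (2 : ℝ) • x = 0 := by
    rw [two_smul]; exact add_eq_zero_iff_eq_neg.2 h
  exact (smul_eq_zero.1 h2).resolve_left two_ne_zero

theorem mem_of_mem_sup_of_star_eq (h𝔨 : ∀ W ∈ 𝔨, star W = -W) (h𝔭 : ∀ Z ∈ 𝔭, star Z = Z)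
    {z : E →L[ℝ] E} (hz : z ∈ 𝔭 ⊔ 𝔨) (hs : star z = z) : z ∈ 𝔭 := by
  obtain ⟨p, hp, k, hk, rfl⟩ := Submodule.mem_sup.1 hz
  rw [star_add, h𝔭 p hp, h𝔨 k hk, add_right_inj] at hs
  rw [eq_zero_of_eq_neg_real hs.symm, add_zero]
  exact hp

theorem mem_of_mem_sup_of_star_eq_neg (h𝔨 : ∀ W ∈ 𝔨, star W = -W) (h𝔭 : ∀ Z ∈ 𝔭, star Z = Z)
    {z : E →L[ℝ] E} (hz : z ∈ 𝔭 ⊔ 𝔨) (hs : star z = -z) : z ∈ 𝔨 := by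
  obtain ⟨p, hp, k, hk, rfl⟩ := Submodule.mem_sup.1 hz
  rw [star_add, h𝔭 p hp, h𝔨 k hk, neg_add, add_left_inj] at hs
  rw [eq_zero_of_eq_neg_real hs, zero_add]
  exact hk

/-- The infinitesimal Cartan decomposition at `exp (-X)`: the derivative of `exp (-X) exp (-h D)`
at `h = 0` is that of a curve `exp (h W) exp (-(X + h D)) exp (h W')` with `W, W' ∈ 𝔨`. -/
theorem exists_skew_infinitesimal (h𝔨 : ∀ W ∈ 𝔨, star W = -W) (h𝔭 : ∀ Z ∈ 𝔭, star Z = Z)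
    {X D : E →L[ℝ] E} (hX : X ∈ 𝔭) (hD : D ∈ 𝔭) (hXp : ∀ Z ∈ 𝔭, X * Z - Z * X ∈ 𝔨)
    (hXk : ∀ W ∈ 𝔨, X * W - W * X ∈ 𝔭) :
    ∃ W ∈ 𝔨, ∃ W' ∈ 𝔨, exp X * W * exp (-X) + W' =
      D - ∫ s in (0 : ℝ)..1, exp (s • X) * D * exp (-(s • X)) := by
  let _ : NormedAlgebra ℚ (E →L[ℝ] E) := NormedAlgebra.restrictScalars ℚ ℝ _
  have hexp := continuous_exp_of_real (A := E →L[ℝ] E)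
  have hXs : star X = X := h𝔭 X hX
  have hP : star (exp X) = exp X := by rw [star_exp, hXs]
  have hQ : star (exp (-X)) = exp (-X) := by rw [star_exp, star_neg, hXs]
  have hcl : IsClosed ((𝔭 ⊔ 𝔨 : Submodule ℝ (E →L[ℝ] E)) : Set (E →L[ℝ] E)) :=
    Submodule.closed_of_finiteDimensional _
  -- `ad X` exchanges `𝔭` and `𝔨`, hence preserves their sum, and so does its exponential.
  have hinv : ∀ s : ℝ, ∀ z ∈ 𝔭 ⊔ 𝔨, exp (s • X) * z * exp (-(s • X)) ∈ 𝔭 ⊔ 𝔨 := by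
    intro s z hz
    rw [← exp_adL_apply]
    refine exp_apply_mem_of_invariant _ _ hcl (fun v hv => ?_) hz
    obtain ⟨p, hp, k, hk, rfl⟩ := Submodule.mem_sup.1 hv
    have e : adL (s • X) (p + k) = s • (X * k - k * X) + s • (X * p - p * X) := by
      simp only [adL_apply, smul_mul_assoc, mul_smul_comm, ← smul_sub, ← smul_add]
      congr 1; noncomm_ring
    rw [e]
    exact Submodule.add_mem_sup (𝔭.smul_mem _ (hXk k hk)) (𝔨.smul_mem _ (hXp p hp))
  have hinv1 : ∀ z ∈ 𝔭 ⊔ 𝔨, exp X * z * exp (-X) ∈ 𝔭 ⊔ 𝔨 := fun z hz => by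
    simpa using hinv 1 z hz
  have hinv2 : ∀ z ∈ 𝔭 ⊔ 𝔨, exp (-X) * z * exp X ∈ 𝔭 ⊔ 𝔨 := fun z hz => by
    simpa using hinv (-1) z hz
  set F := ∫ s in (0 : ℝ)..1, exp (s • X) * D * exp (-(s • X)) with hF
  have hFmem : F ∈ 𝔭 ⊔ 𝔨 := integral_unitInterval_mem _ hcl (by fun_prop)
    fun s => hinv s D (Submodule.mem_sup_left hD)
  have hstar : ∀ z ∈ 𝔭 ⊔ 𝔨, star z ∈ 𝔭 ⊔ 𝔨 := by
    intro z hz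
    obtain ⟨p, hp, k, hk, rfl⟩ := Submodule.mem_sup.1 hz
    rw [star_add, h𝔭 p hp, h𝔨 k hk]
    exact Submodule.add_mem_sup hp (𝔨.neg_mem hk)
  let T : (E →L[ℝ] E) →ₗ[ℝ] (E →L[ℝ] E) :=
    { toFun := fun z => exp X * z * exp (-X) - exp (-X) * z * exp X
      map_add' := fun z w => by noncomm_ring
      map_smul' := fun r z => by simp [smul_sub] }
  have hT : ∀ z, T z = exp X * z * exp (-X) - exp (-X) * z * exp X := fun z => rfl
  have hTmem : ∀ z ∈ 𝔭 ⊔ 𝔨, T z ∈ 𝔭 ⊔ 𝔨 := fun z hz =>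
    Submodule.sub_mem _ (hinv1 z hz) (hinv2 z hz)
  have hTstar : ∀ z, star (T z) = -T (star z) := by
    intro z
    simp only [hT, star_sub, star_mul, hP, hQ, mul_assoc, neg_sub]
  -- A skew `W'` solving the equation exists as soon as the self-adjoint parts agree. Twice the
  -- self-adjoint part of `exp X W exp(-X)` is `T W` for skew `W`, so the equation to solve is `T W
  -- = R`.
  set R := D - F + star (D - F) with hR
  have hRmem : R ∈ 𝔭 := by
    have h1 : D - F ∈ 𝔭 ⊔ 𝔨 := Submodule.sub_mem _ (Submodule.mem_sup_left hD) hFmem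
    refine mem_of_mem_sup_of_star_eq h𝔨 h𝔭 (Submodule.add_mem _ h1 (hstar _ h1)) ?_
    rw [star_add, star_star, add_comm]
  obtain ⟨W, hW, hTW⟩ := exists_apply_eq_of_orthogonal_ker hsEmbed hsEmbed_injective T
    (fun x y => by
      change hsInner (T x) y = hsInner x (T y)
      rw [hT, hT, hsInner_sub_left, hsInner_sub_right, hsInner_conj_left hP hQ,
        hsInner_conj_left hQ hP])
    (𝔨 := 𝔨) (𝔭 := 𝔭)
    (fun w hw => mem_of_mem_sup_of_star_eq h𝔨 h𝔭 (hTmem w (Submodule.mem_sup_right hw))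
      (by rw [hTstar, h𝔨 w hw, map_neg, neg_neg]))
    (fun z hz => mem_of_mem_sup_of_star_eq_neg h𝔨 h𝔭 (hTmem z (Submodule.mem_sup_left hz))
      (by rw [hTstar, h𝔭 z hz]))
    hRmem
    -- Solvability: an element of the kernel of `T` in `𝔭` commutes with `X`, hence pairs equally
    -- with `D` and `F`.
    (fun z hz hTz => by
      have h1 := commute_of_exp_conj_eq hXs (sub_eq_zero.1 hTz)
      have h2 := hsInner_integral_conj_of_commute (D := D) hXs h1
      have h3 : hsInner (D - F) z = 0 := by rw [hsInner_sub_left, h2, sub_self]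
      have h4 : hsInner (star (D - F)) z = 0 := by
        rw [← h𝔭 z hz, hsInner_star_star, h3]
      have h5 : hsInner R z = hsInner (D - F) z + hsInner (star (D - F)) z := by
        simp [hsInner, hR, inner_add_left]
      exact h5.trans (by rw [h3, h4, add_zero]))
  refine ⟨W, hW, D - F - exp X * W * exp (-X), ?_, by abel⟩
  refine mem_of_mem_sup_of_star_eq_neg h𝔨 h𝔭 (Submodule.sub_mem _ (Submodule.sub_mem _
    (Submodule.mem_sup_left hD) hFmem) (hinv1 W (Submodule.mem_sup_right hW))) ?_
  have e1 : star (exp X * W * exp (-X)) = -(exp (-X) * W * exp X) := by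
    simp only [star_mul, hP, hQ, h𝔨 W hW, mul_neg, neg_mul, mul_assoc]
  have e2 : star (D - F) = exp X * W * exp (-X) - exp (-X) * W * exp X - (D - F) := by
    rw [← hT, hTW, hR]; abel
  rw [star_sub, e1, e2]
  abel

end Infinitesimal

/-! ### Viability: products of exponentials stay in `exp(-c) K`. -/

section ConeSemigroup

open NormedSpace Filter

variable {E : Type*} [NormedAddCommGroup E] [InnerProductSpace ℝ E] [FiniteDimensional ℝ E]

/-- A cone of positive operators adapted to a compact group `K` of orthogonal operators and a
space `𝔨` of infinitesimal generators of `K`. -/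
structure IsCartanCone (c : ProperCone ℝ (E →L[ℝ] E)) (𝔨 : Submodule ℝ (E →L[ℝ] E))
    (K : Subgroup (E →L[ℝ] E)ˣ) : Prop where
  isPositive : ∀ C ∈ c, ContinuousLinearMap.IsPositive C
  commutator_mem : ∀ C ∈ c, ∀ D ∈ c, C * D - D * C ∈ 𝔨
  commutator_mem_span : ∀ C ∈ c, ∀ W ∈ 𝔨, C * W - W * C ∈ Submodule.span ℝ (c : Set (E →L[ℝ] E))
  conj_mem : ∀ k ∈ K, ∀ C ∈ c, (k : E →L[ℝ] E) * C * (k⁻¹ : (E →L[ℝ] E)ˣ) ∈ c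
  star_eq_neg : ∀ W ∈ 𝔨, star W = -W
  star_eq_inv : ∀ k ∈ K, star (k : E →L[ℝ] E) = (k⁻¹ : (E →L[ℝ] E)ˣ)
  expUnit_mem : ∀ W ∈ 𝔨, expUnit W ∈ K
  isCompact : IsCompact (Units.val '' (K : Set (E →L[ℝ] E)ˣ))

theorem norm_one_clm_le {F : Type*} [NormedAddCommGroup F] [NormedSpace ℝ F] :
    ‖(1 : F →L[ℝ] F)‖ ≤ 1 := ContinuousLinearMap.norm_id_le

/-- Graded version of `exp (-c) K`: the second coordinate bounds the norm of the cone part. -/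
def gradedCone (c : ProperCone ℝ (E →L[ℝ] E)) (K : Subgroup (E →L[ℝ] E)ˣ) :
    Set ((E →L[ℝ] E) × ℝ) :=
  {q | ∃ X ∈ c, ∃ k ∈ K, q.1 = exp (-X) * (k : E →L[ℝ] E) ∧ ‖X‖ ≤ q.2}

namespace IsCartanCone

variable {c : ProperCone ℝ (E →L[ℝ] E)} {𝔨 : Submodule ℝ (E →L[ℝ] E)}
  {K : Subgroup (E →L[ℝ] E)ˣ} (h : IsCartanCone c 𝔨 K)

include h

theorem star_eq_self {C : E →L[ℝ] E} (hC : C ∈ Submodule.span ℝ (c : Set (E →L[ℝ] E))) :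
    star C = C := by
  induction hC using Submodule.span_induction with
  | mem x hx => exact (h.isPositive x hx).isSelfAdjoint
  | zero => simp
  | add x y _ _ hx hy => rw [star_add, hx, hy]
  | smul r x _ hx => rw [star_smul, hx, star_trivial]

theorem commutator_span_mem {C : E →L[ℝ] E} (hC : C ∈ c) {Z : E →L[ℝ] E}
    (hZ : Z ∈ Submodule.span ℝ (c : Set (E →L[ℝ] E))) : C * Z - Z * C ∈ 𝔨 := by
  induction hZ using Submodule.span_induction with
  | mem x hx => exact h.commutator_mem C hC x hx
  | zero => simp
  | add x y _ _ hx hy =>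
    rw [mul_add, add_mul, add_sub_add_comm]; exact 𝔨.add_mem hx hy
  | smul r x _ hx =>
    rw [mul_smul_comm, smul_mul_assoc, ← smul_sub]; exact 𝔨.smul_mem _ hx

theorem norm_le_one {k : (E →L[ℝ] E)ˣ} (hk : k ∈ K) : ‖(k : E →L[ℝ] E)‖ ≤ 1 := by
  have h1 := CStarRing.norm_star_mul_self (x := (k : E →L[ℝ] E))
  rw [h.star_eq_inv k hk, Units.inv_mul] at h1
  have h2 := norm_one_clm_le (F := E)
  nlinarith [norm_nonneg (k : E →L[ℝ] E)]

theorem norm_conj_le {k : (E →L[ℝ] E)ˣ} (hk : k ∈ K) (C : E →L[ℝ] E) :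
    ‖(k : E →L[ℝ] E) * C * (k⁻¹ : (E →L[ℝ] E)ˣ)‖ ≤ ‖C‖ := by
  refine (norm_mul_le _ _).trans ?_
  refine (mul_le_mul (norm_mul_le _ _) (h.norm_le_one (K.inv_mem hk)) (norm_nonneg _)
    (by positivity)).trans ?_
  rw [mul_one]
  exact mul_le_of_le_one_left (norm_nonneg _) (h.norm_le_one hk)

/-- A convergent sequence has bounded second coordinates, so its cone parts lie in a ball and a
subsequence of the pairs `(X, k)` converges. Without the grading, limits in the operator space could
be singular. -/
theorem isClosed_gradedCone : IsClosed (gradedCone c K) := by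
  refine IsSeqClosed.isClosed fun q p hq hqp => ?_
  choose X hX k hk hqk hXn using hq
  obtain ⟨R, hR⟩ := ((continuous_snd.tendsto p).comp hqp).bddAbove_range
  have hcomp : IsCompact (Metric.closedBall (0 : E →L[ℝ] E) R ×ˢ
      (Units.val '' (K : Set (E →L[ℝ] E)ˣ))) := (isCompact_closedBall _ _).prod h.isCompact
  obtain ⟨⟨Y, l⟩, ⟨-, ⟨l, hl, rfl⟩⟩, φ, hφ, hlim⟩ := hcomp.tendsto_subseq
    (x := fun n => (X n, (k n : E →L[ℝ] E))) (fun n => ⟨by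
      rw [mem_closedBall_zero_iff]
      exact (hXn n).trans (hR ⟨n, rfl⟩), ⟨k n, hk n, rfl⟩⟩)
  have hXlim : Tendsto (fun n => X (φ n)) atTop (𝓝 Y) := (continuous_fst.tendsto _).comp hlim
  have hklim : Tendsto (fun n => (k (φ n) : E →L[ℝ] E)) atTop (𝓝 l) :=
    (continuous_snd.tendsto _).comp hlim
  have hqφ := hqp.comp hφ.tendsto_atTop
  refine ⟨Y, c.isClosed.mem_of_tendsto hXlim (Eventually.of_forall fun n => hX _), l, hl, ?_, ?_⟩
  · refine tendsto_nhds_unique ((continuous_fst.tendsto p).comp hqφ) ?_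
    have := (((continuous_exp_of_real (A := E →L[ℝ] E)).tendsto _).comp hXlim.neg).mul hklim
    exact this.congr fun n => (hqk (φ n)).symm
  · exact le_of_tendsto_of_tendsto' hXlim.norm ((continuous_snd.tendsto p).comp hqφ)
      fun n => hXn (φ n)

/-- The left factor `a` passes through the exponential at the cost of replacing `X` by `a X a⁻¹`,
which does not increase the norm. -/
theorem exp_mul_mem_gradedCone {X : E →L[ℝ] E} {a b u : (E →L[ℝ] E)ˣ} {ρ : ℝ}
    (hX : X ∈ c) (ha : a ∈ K) (hb : b ∈ K) (hu : u ∈ K) (hρ : ‖X‖ ≤ ρ) :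
    (((a : E →L[ℝ] E) * exp (-X) * b * u, ρ) : (E →L[ℝ] E) × ℝ) ∈ gradedCone c K := by
  refine ⟨(a : E →L[ℝ] E) * X * (a⁻¹ : (E →L[ℝ] E)ˣ), h.conj_mem a ha X hX, a * b * u,
    K.mul_mem (K.mul_mem ha hb) hu, ?_, (h.norm_conj_le ha X).trans hρ⟩
  have e : -((a : E →L[ℝ] E) * X * (a⁻¹ : (E →L[ℝ] E)ˣ)) =
      (a : E →L[ℝ] E) * (-X) * (a⁻¹ : (E →L[ℝ] E)ˣ) := by noncomm_ring
  rw [e, exp_conj_unit]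
  simp [mul_assoc]

/-- First-order approximation of `exp (-X) exp (-t D)` by elements of `exp (-c) K`. -/
theorem exists_approx {X D : E →L[ℝ] E} (hX : X ∈ c) (hD : D ∈ c) :
    ∃ W ∈ 𝔨, ∃ W' ∈ 𝔨, HasDerivAt (fun t : ℝ => exp (-X) * exp (-(t • D)) -
      exp (-(t • W)) * exp (-(X + t • D)) * exp (-(t • W'))) 0 0 := by
  obtain ⟨W, hW, W', hW', hWW⟩ := exists_skew_infinitesimal h.star_eq_neg
    (fun Z hZ => h.star_eq_self hZ) (Submodule.subset_span hX) (Submodule.subset_span hD)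
    (fun Z hZ => h.commutator_span_mem hX hZ) (fun Z hZ => h.commutator_mem_span X hX Z hZ)
  refine ⟨W, hW, W', hW', ?_⟩
  have h1 := (hasDerivAt_exp_neg_smul_zero D).const_mul (exp (-X))
  have h2 := (hasDerivAt_exp_mul_exp_neg_add X D).const_mul (exp (-X))
  simp only [← mul_assoc, exp_neg_mul_exp, one_mul] at h2
  have h3 := ((hasDerivAt_exp_neg_smul_zero W).mul h2).mul (hasDerivAt_exp_neg_smul_zero W')
  refine (h1.sub h3).congr_deriv ?_
  simp only [Pi.mul_apply, zero_smul, neg_zero, exp_zero, add_zero, one_mul, mul_one]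
  have e : exp (-X) * (exp X * W * exp (-X)) = W * exp (-X) := by
    rw [← mul_assoc, ← mul_assoc, exp_neg_mul_exp, one_mul]
  have e2 := congrArg (fun z => exp (-X) * z) hWW
  simp only [mul_add, mul_sub, e] at e2
  rw [sub_eq_zero, mul_neg, mul_neg, mul_neg, neg_mul]
  rw [eq_sub_iff_add_eq] at e2
  rw [← e2]
  abel

/-- The distance from the curve to the closed graded set starts at `0` and has upper right
derivative at most `0`, so it stays `0`. The grade grows at speed `‖D‖`, which accommodates the step
from `X` to `X + τD'`. -/
theorem exp_neg_mul_exp_neg_mem_gradedCone {C D : E →L[ℝ] E} (hC : C ∈ c) (hD : D ∈ c) {t : ℝ}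
    (ht : 0 ≤ t) :
    ((exp (-C) * exp (-(t • D)), ‖C‖ + t * ‖D‖) : (E →L[ℝ] E) × ℝ) ∈ gradedCone c K := by
  have hexp := continuous_exp_of_real (A := E →L[ℝ] E)
  set γ : ℝ → (E →L[ℝ] E) × ℝ := fun t => (exp (-C) * exp (-(t • D)), ‖C‖ + t * ‖D‖) with hγ
  have hγc : Continuous γ := by fun_prop
  have hγ0 : γ 0 ∈ gradedCone c K := ⟨C, hC, 1, K.one_mem, by simp [hγ], by simp [hγ]⟩
  have hcl := h.isClosed_gradedCone
  have hne : (gradedCone c K).Nonempty := ⟨_, hγ0⟩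
  set f : ℝ → ℝ := fun t => Metric.infDist (γ t) (gradedCone c K) with hf
  have hfc : Continuous f := (Metric.continuous_infDist_pt _).comp hγc
  have hslope : ∀ x, ∀ r, 0 < r → ∀ᶠ z in 𝓝[>] x, slope f x z < r := by
    intro x r hr
    obtain ⟨⟨s, ρ⟩, ⟨X, hX, k, hk, hs, hXρ⟩, hdist⟩ := hcl.exists_infDist_eq_dist hne (γ x)
    simp only at hs hXρ
    -- Conjugating `D` lets `k` move to the right: `exp(-X) k exp(-τD) = exp(-X) exp(-τD') k`.
    set D' : E →L[ℝ] E := (k : E →L[ℝ] E) * D * (k⁻¹ : (E →L[ℝ] E)ˣ) with hD'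
    have hD'c : D' ∈ c := h.conj_mem k hk D hD
    obtain ⟨W, hW, W', hW', hder⟩ := h.exists_approx hX hD'c
    set δ : ℝ → (E →L[ℝ] E) := fun t => exp (-X) * exp (-(t • D')) -
      exp (-(t • W)) * exp (-(X + t • D')) * exp (-(t • W')) with hδ
    have hδ0 : δ 0 = 0 := by simp [hδ]
    have hsmall : ∀ᶠ z in 𝓝[>] x, ‖δ (z - x)‖ ≤ r / 2 * (z - x) := by
      have h1 := (hasDerivAt_iff_isLittleO.1 hder).def (half_pos hr)
      simp only [hδ0, sub_zero, smul_zero] at h1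
      have h2 : Tendsto (fun z : ℝ => z - x) (𝓝[>] x) (𝓝 0) := by
        have : Tendsto (fun z : ℝ => z - x) (𝓝 x) (𝓝 (x - x)) :=
          (continuous_id.sub continuous_const).tendsto x
        rw [sub_self] at this
        exact this.mono_left nhdsWithin_le_nhds
      filter_upwards [h2.eventually h1, self_mem_nhdsWithin] with z hz hzx
      rwa [Real.norm_of_nonneg (sub_nonneg.2 (le_of_lt hzx))] at hz
    filter_upwards [hsmall, self_mem_nhdsWithin] with z hz hzx
    have hzx' : 0 < z - x := sub_pos.2 hzx
    set τ := z - x with hτ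
    set σ : E →L[ℝ] E := exp (-(τ • W)) * exp (-(X + τ • D')) * exp (-(τ • W')) with hσ
    have hmem : ((σ * k, ρ + τ * ‖D‖) : (E →L[ℝ] E) × ℝ) ∈ gradedCone c K := by
      refine h.exp_mul_mem_gradedCone (X := X + τ • D') (a := expUnit (-(τ • W)))
        (b := expUnit (-(τ • W'))) (u := k) (c.add_mem hX (c.smul_mem hD'c hzx'.le))
        (h.expUnit_mem _ (𝔨.neg_mem (𝔨.smul_mem _ hW)))
        (h.expUnit_mem _ (𝔨.neg_mem (𝔨.smul_mem _ hW'))) hk ?_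
      refine (norm_add_le _ _).trans (add_le_add hXρ ?_)
      rw [norm_smul, Real.norm_of_nonneg hzx'.le]
      exact mul_le_mul_of_nonneg_left (h.norm_conj_le hk D) hzx'.le
    have hstep : exp (-(z • D)) = exp (-(x • D)) * exp (-(τ • D)) := by
      rw [← exp_add_of_commute_of_real, ← neg_add, ← add_smul, hτ, add_sub_cancel]
      exact (((Commute.refl D).smul_left x).smul_right τ).neg_left.neg_right
    have hconj : s * exp (-(τ • D)) = exp (-X) * exp (-(τ • D')) * k := by
      have e : -(τ • D') = (k : E →L[ℝ] E) * (-(τ • D)) * (k⁻¹ : (E →L[ℝ] E)ˣ) := by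
        rw [hD']; simp [mul_assoc]
      rw [e, exp_conj_unit, hs]
      simp [mul_assoc]
    have hle : f z ≤ f x + ‖δ τ‖ := by
      refine (Metric.infDist_le_dist_of_mem hmem).trans ?_
      have hfx : f x = dist (γ x) (s, ρ) := hdist
      rw [hfx]
      rw [Prod.dist_eq, Prod.dist_eq]
      refine max_le ?_ ?_
      -- The old displacement is multiplied by a contraction; only the first-order error `δ τ =
      -- o(τ)` is added.
      · have e : (γ z).1 - σ * k = ((γ x).1 - s) * exp (-(τ • D)) + δ τ * k := by
          have e1 : δ τ = exp (-X) * exp (-(τ • D')) - σ := rfl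
          rw [sub_mul, hconj, e1, sub_mul]
          simp only [hγ]
          rw [hstep, ← mul_assoc]
          abel
        rw [dist_eq_norm, dist_eq_norm, e]
        refine (norm_add_le _ _).trans (add_le_add (le_trans ?_ (le_max_left _ _)) ?_)
        · exact (norm_mul_le _ _).trans (mul_le_of_le_one_right (norm_nonneg _)
            (norm_exp_neg_le_one (h.isPositive _ (c.smul_mem hD hzx'.le))))
        · exact (norm_mul_le _ _).trans (mul_le_of_le_one_right (norm_nonneg _)
            (h.norm_le_one hk))
      · have e : dist (γ z).2 (ρ + τ * ‖D‖) = dist (γ x).2 ρ := by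
          simp only [hγ, Real.dist_eq, hτ]
          congr 1; ring
        change dist (γ z).2 (ρ + τ * ‖D‖) ≤ _
        rw [e]
        exact (le_max_right _ _).trans (le_add_of_nonneg_right (norm_nonneg _))
    rw [slope_def_field, div_lt_iff₀ hzx']
    calc f z - f x ≤ ‖δ τ‖ := by linarith
      _ ≤ r / 2 * τ := hz
      _ < r * τ := by nlinarith
  have hle := image_le_of_liminf_slope_right_le_deriv_boundary (f := f) (a := 0) (b := t)
    hfc.continuousOn (B := fun _ => 0) (B' := fun _ => 0)
    (by simp [hf, Metric.infDist_zero_of_mem hγ0]) continuousOn_const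
    (fun x _ => hasDerivWithinAt_const _ _ _)
    (fun x _ r hr => (hslope x r hr).frequently) (right_mem_Icc.2 ht)
  exact (hcl.mem_iff_infDist_zero hne).2 (le_antisymm hle Metric.infDist_nonneg)

end IsCartanCone

end ConeSemigroup

/-! ### Closedness and the Lie wedge of `exp(-c) K`. -/

section ConeSemigroupTangent

open NormedSpace Filter Asymptotics

theorem isEquivalent_exp_sub_one {A α : Type*} [NormedRing A] [NormedAlgebra ℝ A]
    [CompleteSpace A] {l : Filter α} {y : α → A} (hy : Tendsto y l (𝓝 0)) :
    IsEquivalent l (fun t => exp (y t) - 1) y := by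
  have h := (hasFDerivAt_iff_isLittleO.1 (hasFDerivAt_exp_zero (𝕂 := ℝ) (𝔸 := A))).comp_tendsto hy
  simpa [IsEquivalent, Function.comp_def, Pi.sub_def] using h

theorem tendsto_smul_of_isEquivalent {V α : Type*} [NormedAddCommGroup V] [NormedSpace ℝ V]
    {l : Filter α} {u v : α → V} (h : IsEquivalent l u v) {r : α → ℝ} {a : V}
    (hv : Tendsto (fun t => r t • v t) l (𝓝 a)) : Tendsto (fun t => r t • u t) l (𝓝 a) := by
  have h1 : (fun t => r t • (u - v) t) =o[l] fun t => r t • v t :=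
    (isBigO_refl r l).smul_isLittleO h
  have h2 : Tendsto (fun t => r t • (u - v) t) l (𝓝 0) :=
    (isLittleO_one_iff ℝ).1 (h1.trans_isBigO (hv.isBigO_one ℝ))
  have h3 := h2.add hv
  simp only [Pi.sub_apply, smul_sub, sub_add_cancel, zero_add] at h3
  exact h3

variable {E : Type*} [NormedAddCommGroup E] [InnerProductSpace ℝ E] [FiniteDimensional ℝ E]

/-- The set `exp (-c) K`. -/
def expCone (c : ProperCone ℝ (E →L[ℝ] E)) (K : Subgroup (E →L[ℝ] E)ˣ) : Set (E →L[ℝ] E)ˣ :=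
  {T | ∃ X ∈ c, ∃ k ∈ K, T = expUnit (-X) * k}

namespace IsCartanCone

variable {c : ProperCone ℝ (E →L[ℝ] E)} {𝔨 : Submodule ℝ (E →L[ℝ] E)}
  {K : Subgroup (E →L[ℝ] E)ˣ}

/-- `exp (-c) K` is a semigroup. -/
def submonoid (h : IsCartanCone c 𝔨 K) : Submonoid (E →L[ℝ] E)ˣ where
  carrier := expCone c K
  one_mem' := ⟨0, c.zero_mem, 1, K.one_mem, by simp [expUnit_zero]⟩
  mul_mem' := by
    rintro _ _ ⟨X, hX, k, hk, rfl⟩ ⟨Y, hY, l, hl, rfl⟩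
    -- `exp(-X) k exp(-Y) l = exp(-X) exp(-kYk⁻¹) (k l)`.
    have hY' := h.conj_mem k hk Y hY
    obtain ⟨Z, hZ, u, hu, e, -⟩ := h.exp_neg_mul_exp_neg_mem_gradedCone hX hY' zero_le_one
    refine ⟨Z, hZ, u * (k * l), K.mul_mem hu (K.mul_mem hk hl), ?_⟩
    have e2 : expUnit (-X) * expUnit (-((k : E →L[ℝ] E) * Y * (k⁻¹ : (E →L[ℝ] E)ˣ))) =
        expUnit (-Z) * u := by
      ext1
      simpa [val_expUnit] using e
    have e3 : -((k : E →L[ℝ] E) * Y * (k⁻¹ : (E →L[ℝ] E)ˣ)) =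
      (k : E →L[ℝ] E) * (-Y) * (k⁻¹ : (E →L[ℝ] E)ˣ) := by noncomm_ring
    rw [e3, expUnit_conj] at e2
    rw [← mul_assoc (expUnit (-Z)), ← e2]
    group

variable (h : IsCartanCone c 𝔨 K)

include h

/-- In `GL` the inverses converge too, hence are bounded. As `exp X = k u⁻¹`, this bounds `‖X‖`, and
the sequence lies in a single grade. -/
theorem isClosed_submonoid : IsClosed (h.submonoid : Set (E →L[ℝ] E)ˣ) := by
  have := (Units.isOpenEmbedding_val (R := E →L[ℝ] E)).isInducing.firstCountableTopology
  refine isClosed_of_closure_subset fun x hx => ?_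
  obtain ⟨u, hu, hux⟩ := mem_closure_iff_seq_limit.1 hx
  choose X hX k hk huk using hu
  have hinv : Tendsto (fun n => ((u n)⁻¹ : (E →L[ℝ] E)ˣ).val) atTop (𝓝 (x⁻¹ : (E →L[ℝ] E)ˣ).val) :=
    (Units.continuous_val.tendsto _).comp hux.inv
  obtain ⟨R, hR⟩ := hinv.norm.bddAbove_range
  have hbd : ∀ n, ‖X n‖ ≤ R + 1 := by
    intro n
    have e : exp (X n) = (k n : E →L[ℝ] E) * ((u n)⁻¹ : (E →L[ℝ] E)ˣ) := by
      rw [huk n, mul_inv_rev, inv_expUnit, neg_neg, Units.val_mul, Units.mul_inv_cancel_left,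
        val_expUnit]
    refine (norm_le_norm_exp_sub_one (h.isPositive _ (hX n))).trans ?_
    refine (norm_sub_le _ _).trans (add_le_add ?_ norm_one_clm_le)
    rw [e]
    exact (norm_mul_le _ _).trans ((mul_le_of_le_one_left (norm_nonneg _)
      (h.norm_le_one (hk n))).trans (hR ⟨n, rfl⟩))
  have hmem : ((x : E →L[ℝ] E), R + 1) ∈ gradedCone c K := by
    refine h.isClosed_gradedCone.mem_of_tendsto (b := atTop)
      (f := fun n => ((u n : E →L[ℝ] E), R + 1)) ?_ (Eventually.of_forall fun n => ?_)
    · exact ((Units.continuous_val.tendsto _).comp hux).prodMk_nhds tendsto_const_nhds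
    · exact ⟨X n, hX n, k n, hk n, by rw [huk n]; rfl, hbd n⟩
  obtain ⟨Y, hY, l, hl, e, -⟩ := hmem
  exact ⟨Y, hY, l, hl, Units.ext e⟩

theorem exp_two_smul_eq {γ : (E →L[ℝ] E)ˣ} {X : E →L[ℝ] E} (hX : X ∈ c) {k : (E →L[ℝ] E)ˣ}
    (hk : k ∈ K) (hγ : γ = expUnit (-X) * k) :
    exp (-((2 : ℝ) • X)) = (γ : E →L[ℝ] E) * star (γ : E →L[ℝ] E) := by
  have hs : star (exp (-X)) = exp (-X) := by
    have := star_exp_neg_smul (h.star_eq_self (Submodule.subset_span hX)) 1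
    rwa [one_smul] at this
  rw [hγ, Units.val_mul, star_mul, h.star_eq_inv k hk, val_expUnit, hs, mul_assoc,
    Units.mul_inv_cancel_left, ← exp_add_of_commute_of_real (Commute.refl _), two_smul, neg_add]

/-- Tangent vectors of `exp (-c) K` at the identity, provided that those of `K` lie in `𝔨`. -/
theorem exists_of_mem_tangentCone
    (htan : ∀ (u : ℝ → (E →L[ℝ] E)ˣ) (W : E →L[ℝ] E), (∀ t, 0 < t → u t ∈ K) →
      Tendsto (fun t : ℝ => t⁻¹ • ((u t : E →L[ℝ] E) - 1)) (𝓝[>] 0) (𝓝 W) → W ∈ 𝔨)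
    {g : E →L[ℝ] E} (hg : g ∈ tangentCone (expCone c K)) : ∃ C ∈ c, ∃ W ∈ 𝔨, g = -C + W := by
  obtain ⟨γ, -, h0, hmem, hder⟩ := hg
  have hmem' : ∀ t, ∃ X ∈ c, ∃ k ∈ K, 0 ≤ t → γ t = expUnit (-X) * k := by
    intro t
    by_cases ht : 0 ≤ t
    · obtain ⟨X, hX, k, hk, e⟩ := hmem t ht
      exact ⟨X, hX, k, hk, fun _ => e⟩
    -- Arbitrary values at negative times.
    · exact ⟨0, c.zero_mem, 1, K.one_mem, fun h => absurd h ht⟩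
  choose X hX k hk hγ using hmem'
  set f : ℝ → (E →L[ℝ] E) := fun t => γ t with hf
  have hslope : ∀ {f : ℝ → (E →L[ℝ] E)} {v : E →L[ℝ] E}, f 0 = 1 →
      HasDerivWithinAt f v (Ici 0) 0 →
      Tendsto (fun t : ℝ => t⁻¹ • (f t - 1)) (𝓝[>] 0) (𝓝 v) := by
    intro f v hf0 hv
    have := hasDerivWithinAt_iff_tendsto_slope.1 hv
    rw [Ici_sdiff_left] at this
    exact this.congr fun t => by simp [slope_def_module, hf0]
  have hlim : ∀ {f : ℝ → (E →L[ℝ] E)} {v : E →L[ℝ] E}, f 0 = 1 →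
      HasDerivWithinAt f v (Ici 0) 0 → Tendsto f (𝓝[>] 0) (𝓝 1) := by
    intro f v hf0 hv
    have := hv.continuousWithinAt.tendsto
    rw [hf0] at this
    exact this.mono_left (nhdsWithin_mono _ Ioi_subset_Ici_self)
  have hf0 : f 0 = 1 := by simp [hf, h0]
  -- The `K`-part cancels in `f f*`, leaving the differentiable curve `exp(-2X)`.
  set G : ℝ → (E →L[ℝ] E) := fun t => f t * star (f t) with hG
  have hG0 : G 0 = 1 := by simp [hG, hf0]
  have hGder : HasDerivWithinAt G (g + star g) (Ici 0) 0 := by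
    refine (hder.mul hder.star).congr_deriv ?_
    change g * star (f 0) + f 0 * star g = _
    simp [hf0]
  have hGX : ∀ᶠ t in 𝓝[>] (0 : ℝ), exp (-((2 : ℝ) • X t)) = G t := by
    filter_upwards [self_mem_nhdsWithin] with t ht
    exact h.exp_two_smul_eq (hX t) (hk t) (hγ t (le_of_lt ht))
  -- Inverting, `exp(2X) → 1`, and `‖2X‖ ≤ ‖exp(2X) - 1‖`.
  have hX0 : Tendsto X (𝓝[>] 0) (𝓝 0) := by
    have h1 : Tendsto (fun t => Ring.inverse (G t)) (𝓝[>] 0) (𝓝 1) := by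
      have h2 := (NormedRing.inverse_continuousAt (1 : (E →L[ℝ] E)ˣ)).tendsto
      rw [Units.val_one, Ring.inverse_one] at h2
      exact h2.comp (hlim hG0 hGder)
    have h3 : Tendsto (fun t => exp ((2 : ℝ) • X t) - 1) (𝓝[>] 0) (𝓝 0) := by
      rw [← sub_self (1 : E →L[ℝ] E)]
      refine (h1.congr' ?_).sub_const 1
      filter_upwards [hGX] with t ht
      rw [← ht]
      exact (Ring.inverse_unit (expUnit (-((2 : ℝ) • X t)))).trans
        (by rw [val_inv_expUnit, neg_neg])
    have h4 : Tendsto (fun t => (2 : ℝ) • X t) (𝓝[>] 0) (𝓝 0) :=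
      squeeze_zero_norm (fun t => norm_le_norm_exp_sub_one
        (h.isPositive _ (c.smul_mem (hX t) zero_le_two))) (by simpa using h3.norm)
    simpa [smul_smul] using h4.const_smul (2⁻¹ : ℝ)
  set C : E →L[ℝ] E := (-2⁻¹ : ℝ) • (g + star g) with hC
  have hXC : Tendsto (fun t : ℝ => t⁻¹ • X t) (𝓝[>] 0) (𝓝 C) := by
    have h1 : Tendsto (fun t => -((2 : ℝ) • X t)) (𝓝[>] 0) (𝓝 0) := by
      simpa using (hX0.const_smul (2 : ℝ)).neg
    have h2 : Tendsto (fun t : ℝ => t⁻¹ • (exp (-((2 : ℝ) • X t)) - 1)) (𝓝[>] 0)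
        (𝓝 (g + star g)) := by
      refine (hslope hG0 hGder).congr' ?_
      filter_upwards [hGX] with t ht
      rw [ht]
    have h3 := (tendsto_smul_of_isEquivalent (isEquivalent_exp_sub_one h1).symm h2).const_smul
      (-2⁻¹ : ℝ)
    refine h3.congr fun t => ?_
    rw [smul_comm, smul_neg, smul_smul]; norm_num
  have hCc : C ∈ c := by
    refine c.isClosed.mem_of_tendsto hXC ?_
    filter_upwards [self_mem_nhdsWithin] with t ht
    exact c.smul_mem (hX t) (inv_nonneg.2 (le_of_lt ht))
  refine ⟨C, hCc, g + C, htan k _ (fun t _ => hk t) ?_, by abel⟩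
  have h1 := tendsto_smul_of_isEquivalent (isEquivalent_exp_sub_one hX0) hXC
  have h2 : Tendsto (fun t => exp (X t)) (𝓝[>] 0) (𝓝 1) := by
    have := (continuous_exp_of_real (A := E →L[ℝ] E)).tendsto 0
    rw [exp_zero] at this
    exact this.comp hX0
  have h3 := (h2.mul (hslope hf0 hder)).add h1
  rw [one_mul] at h3
  refine h3.congr' ?_
  filter_upwards [self_mem_nhdsWithin] with t ht
  -- So `k - 1 = exp X (f - 1) + (exp X - 1)`; divided by `t`, the limit is `g + C`.
  have e : (k t : E →L[ℝ] E) = exp (X t) * f t := by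
    change _ = exp (X t) * (γ t : E →L[ℝ] E)
    rw [hγ t (le_of_lt ht), Units.val_mul, val_expUnit, ← mul_assoc, exp_mul_exp_neg, one_mul]
  rw [e, mul_smul_comm, ← smul_add]
  congr 1
  noncomm_ring

theorem neg_add_mem_tangentCone {C W : E →L[ℝ] E} (hC : C ∈ c) (hW : W ∈ 𝔨) :
    -C + W ∈ tangentCone (h.submonoid : Set (E →L[ℝ] E)ˣ) := by
  refine ⟨fun t => expUnit (t • -C) * expUnit (t • W), ?_, ?_, fun t ht => ?_, ?_⟩
  · exact ((contDiff_exp_smul (-C)).mul (contDiff_exp_smul W)).contDiffOn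
  · simp [expUnit_zero]
  · exact ⟨t • C, c.smul_mem hC ht, _, h.expUnit_mem _ (𝔨.smul_mem t hW), by simp only [smul_neg]⟩
  · refine HasDerivAt.hasDerivWithinAt ?_
    refine ((hasDerivAt_exp_smul_zero (-C)).mul (hasDerivAt_exp_smul_zero W)).congr_deriv ?_
    simp

/-- A closed semigroup generated by operators `exp (-t (W + C))` lies in `exp (-c) K`. -/
theorem closure_generators_subset {ι : Type*} {x : ι → E →L[ℝ] E}
    (hx : ∀ i, ∃ W ∈ 𝔨, ∃ C ∈ c, x i = W + C) :
    closure (Submonoid.closure {T : (E →L[ℝ] E)ˣ | ∃ (i : ι) (t : ℝ), 0 ≤ t ∧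
      T = expUnit (-(t • x i))} : Set (E →L[ℝ] E)ˣ) ⊆ expCone c K := by
  refine closure_minimal ?_ h.isClosed_submonoid
  change _ ⊆ (h.submonoid : Set (E →L[ℝ] E)ˣ)
  rw [SetLike.coe_subset_coe, Submonoid.closure_le]
  rintro _ ⟨i, t, ht, rfl⟩
  obtain ⟨W, hW, C, hC, e⟩ := hx i
  refine expUnit_mem_of_mem_tangentCone norm_one_clm_le h.isClosed_submonoid ?_
  rw [e, smul_add, neg_add, add_comm, ← neg_smul t W]
  exact h.neg_add_mem_tangentCone (c.smul_mem hC ht) (𝔨.smul_mem _ hW)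

/-- `exp (-c) K` is a Lie subsemigroup if `K` consists of exponentials. -/
theorem isLieSubsemigroup (hK : ∀ k ∈ K, ∃ W ∈ 𝔨, expUnit W = k) :
    IsLieSubsemigroup (expCone c K) := by
  refine isLieSubsemigroup_of_subset_closure norm_one_clm_le h.isClosed_submonoid
    (Subset.trans ?_ subset_closure)
  rintro _ ⟨X, hX, k, hk, rfl⟩
  obtain ⟨W, hW, rfl⟩ := hK k hk
  refine mul_mem (Submonoid.subset_closure ⟨-X, ?_, rfl⟩) (Submonoid.subset_closure ⟨W, ?_, rfl⟩)
  · simpa using h.neg_add_mem_tangentCone hX 𝔨.zero_mem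
  · simpa using h.neg_add_mem_tangentCone c.zero_mem hW

theorem disjoint_span : Disjoint (Submodule.span ℝ (c : Set (E →L[ℝ] E))) 𝔨 := by
  rw [Submodule.disjoint_def]
  intro x hx hx'
  exact eq_zero_of_eq_neg_real ((h.star_eq_self hx).symm.trans (h.star_eq_neg x hx'))

end IsCartanCone

end ConeSemigroupTangent

/-! ### Logarithms of unitary matrices. -/

section MatrixLog

open NormedSpace
open scoped Matrix.Norms.L2Operator

/-- Every unitary matrix is the exponential of a skew-Hermitian matrix. -/
theorem exists_exp_eq_of_mem_unitaryGroup {N : ℕ} {U : Matrix (Fin N) (Fin N) ℂ}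
    (hU : U ∈ Matrix.unitaryGroup (Fin N) ℂ) :
    ∃ Y : Matrix (Fin N) (Fin N) ℂ, Y.conjTranspose = -Y ∧ exp Y = U := by
  have hn : IsStarNormal U := ⟨by
    rw [commute_iff_eq, Matrix.mem_unitaryGroup_iff.1 hU, Matrix.mem_unitaryGroup_iff'.1 hU]⟩
  -- The jump of `arg` is harmless, since the spectrum is finite. The values are imaginary, so the
  -- result is skew-Hermitian.
  set f : ℂ → ℂ := fun z => Complex.I * Complex.arg z with hf
  have hcont : ContinuousOn f (spectrum ℂ U) := (Matrix.finite_spectrum U).continuousOn f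
  have hY : IsStarNormal (cfc f U) := cfc_predicate f U
  refine ⟨cfc f U, ?_, ?_⟩
  · rw [← Matrix.star_eq_conjTranspose, ← cfc_star, ← cfc_neg]
    congr 1
    ext z
    simp [hf]
  · rw [← CFC.complex_exp_eq_normedSpace_exp (a := cfc f U) hY, ← cfc_comp Complex.exp f U hn
      Complex.continuous_exp.continuousOn hcont]
    conv_rhs => rw [← cfc_id ℂ U]
    refine cfc_congr fun z hz => ?_
    have h1 : ‖z‖ = 1 := by
      simpa using spectrum.subset_circle_of_unitary hU hz
    have h2 := Complex.norm_mul_exp_arg_mul_I z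
    rw [h1, Complex.ofReal_one, one_mul] at h2
    simpa [hf, mul_comm] using h2

end MatrixLog

variable {N : ℕ}

/-! ### Adjoints and compactness of `Ad SU(N)`; trace and determinant corrections. -/

section Superoperators

open NormedSpace
open scoped InnerProductSpace

theorem Her0.inner_def (X Y : Her0 N) :
    ⟪X, Y⟫_ℝ = (Her0.toMatrix X * Her0.toMatrix Y).trace.re := rfl

theorem toMatrix_adOp (Y : Matrix (Fin N) (Fin N) ℂ) (hY) (X : Her0 N) :
    Her0.toMatrix (adOp Y hY X) = Y * Her0.toMatrix X - Her0.toMatrix X * Y := rfl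

theorem toMatrix_conjSU (U : Matrix.specialUnitaryGroup (Fin N) ℂ) (X : Her0 N) :
    Her0.toMatrix (conjSU U X) = (U : Matrix (Fin N) (Fin N) ℂ) * Her0.toMatrix X *
      (U : Matrix (Fin N) (Fin N) ℂ).conjTranspose := rfl

theorem val_AdSU (U : Matrix.specialUnitaryGroup (Fin N) ℂ) : (AdSU N U : SuperOp N) = conjSU U :=
  rfl

theorem coe_inv_specialUnitary (U : Matrix.specialUnitaryGroup (Fin N) ℂ) :
    ((U⁻¹ : Matrix.specialUnitaryGroup (Fin N) ℂ) : Matrix (Fin N) (Fin N) ℂ) =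
      (U : Matrix (Fin N) (Fin N) ℂ).conjTranspose := rfl

theorem SuperOp.ext_matrix {S T : SuperOp N}
    (h : ∀ X, Her0.toMatrix (S X) = Her0.toMatrix (T X)) : S = T :=
  ContinuousLinearMap.ext fun X => Her0.toMatrix_injective (h X)

theorem star_conjSU (U : Matrix.specialUnitaryGroup (Fin N) ℂ) :
    star (conjSU U) = conjSU U⁻¹ := by
  refine ((ContinuousLinearMap.eq_adjoint_iff _ _).2 fun X Y => ?_).symm
  rw [Her0.inner_def, Her0.inner_def, toMatrix_conjSU, toMatrix_conjSU, coe_inv_specialUnitary,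
    Matrix.conjTranspose_conjTranspose, mul_assoc, mul_assoc, Matrix.trace_mul_comm]
  simp only [mul_assoc]

theorem star_adOp (Y : Matrix (Fin N) (Fin N) ℂ) (hY : Y.conjTranspose = -Y) :
    star (adOp Y hY) = -adOp Y hY := by
  rw [eq_comm]
  refine (ContinuousLinearMap.eq_adjoint_iff _ _).2 fun X Z => ?_
  rw [Her0.inner_def, Her0.inner_def, toMatrix_adOp, neg_apply, map_neg, toMatrix_adOp]
  congr 1
  simp only [sub_mul, mul_sub, neg_mul, Matrix.trace_sub, Matrix.trace_neg]
  rw [mul_assoc, Matrix.trace_mul_comm Y]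
  simp only [mul_assoc]
  abel

theorem isClosedEmbedding_toMatrix : IsClosedEmbedding (Her0.toMatrix (N := N)) :=
  LinearMap.isClosedEmbedding_of_injective (LinearMap.ker_eq_bot.2 Her0.toMatrix_injective)

theorem continuous_conjSU :
    Continuous (conjSU : Matrix.specialUnitaryGroup (Fin N) ℂ → SuperOp N) := by
  refine continuous_clm_apply.2 fun X => ?_
  refine isClosedEmbedding_toMatrix.isInducing.continuous_iff.2 ?_
  change Continuous fun U : Matrix.specialUnitaryGroup (Fin N) ℂ =>
    (U : Matrix (Fin N) (Fin N) ℂ) * Her0.toMatrix X *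
      (U : Matrix (Fin N) (Fin N) ℂ).conjTranspose
  fun_prop

theorem isCompact_specialUnitaryGroup :
    IsCompact (Matrix.specialUnitaryGroup (Fin N) ℂ : Set (Matrix (Fin N) (Fin N) ℂ)) := by
  have hb : IsCompact (univ.pi fun _ : Fin N => univ.pi fun _ : Fin N =>
      Metric.closedBall (0 : ℂ) 1) :=
    isCompact_univ_pi fun _ => isCompact_univ_pi fun _ => isCompact_closedBall _ _
  refine hb.of_isClosed_subset ?_ fun U hU i _ j _ => ?_
  · have e : (Matrix.specialUnitaryGroup (Fin N) ℂ : Set (Matrix (Fin N) (Fin N) ℂ)) =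
        {U | U * U.conjTranspose = 1} ∩ {U | U.det = 1} := by
      ext U
      rw [SetLike.mem_coe, Matrix.mem_specialUnitaryGroup_iff, Matrix.mem_unitaryGroup_iff]
      rfl
    rw [e]
    exact (isClosed_eq (by fun_prop) continuous_const).inter
      (isClosed_eq (by fun_prop) continuous_const)
  · rw [mem_closedBall_zero_iff]
    exact entry_norm_bound_of_unitary (Matrix.mem_specialUnitaryGroup_iff.1 hU).1 i j

theorem isCompact_range_AdSU :
    IsCompact (Units.val '' ((AdSU N).range : Set (SuperOp N)ˣ)) := by
  have : CompactSpace (Matrix.specialUnitaryGroup (Fin N) ℂ) :=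
    isCompact_iff_compactSpace.1 isCompact_specialUnitaryGroup
  have e : Units.val '' ((AdSU N).range : Set (SuperOp N)ˣ) = range (conjSU (N := N)) := by
    ext T
    constructor
    · rintro ⟨_, ⟨U, rfl⟩, rfl⟩; exact ⟨U, rfl⟩
    · rintro ⟨U, rfl⟩; exact ⟨_, ⟨U, rfl⟩, rfl⟩
  rw [e]
  exact isCompact_range continuous_conjSU

/-- Subtracting the trace part does not change a commutator. -/
theorem exists_traceless_skew {Y : Matrix (Fin N) (Fin N) ℂ} (hY : Y.conjTranspose = -Y) :
    ∃ (Z : Matrix (Fin N) (Fin N) ℂ) (hZ : Z.conjTranspose = -Z),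
      Z.trace = 0 ∧ adOp Z hZ = adOp Y hY := by
  have htr : star Y.trace = -Y.trace := by
    rw [← Matrix.trace_conjTranspose, hY, Matrix.trace_neg]
  refine ⟨Y - (Y.trace / N) • 1, ?_, ?_, ?_⟩
  · rw [Matrix.conjTranspose_sub, hY, Matrix.conjTranspose_smul, Matrix.conjTranspose_one,
      star_div₀, htr]
    simp [neg_div]
    abel
  · rcases Nat.eq_zero_or_pos N with rfl | hN
    · simp [Matrix.trace]
    · have : (N : ℂ) ≠ 0 := by exact_mod_cast hN.ne'
      rw [Matrix.trace_sub, Matrix.trace_smul, Matrix.trace_one, Fintype.card_fin, smul_eq_mul,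
        div_mul_cancel₀ _ this, sub_self]
  · refine SuperOp.ext_matrix fun X => ?_
    rw [toMatrix_adOp, toMatrix_adOp, sub_mul, mul_sub, smul_mul_assoc, mul_smul_comm, one_mul,
      mul_one, sub_sub_sub_cancel_right]

/-- Conjugation by a unitary matrix is conjugation by a special unitary one. -/
theorem exists_specialUnitary_smul {U : Matrix (Fin N) (Fin N) ℂ}
    (hU : U ∈ Matrix.unitaryGroup (Fin N) ℂ) :
    ∃ z : ℂ, z * star z = 1 ∧ z • U ∈ Matrix.specialUnitaryGroup (Fin N) ℂ := by
  have hd : ‖U.det‖ = 1 := by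
    have h := congrArg Matrix.det (Matrix.mem_unitaryGroup_iff.1 hU)
    rw [Matrix.det_mul, Matrix.star_eq_conjTranspose, Matrix.det_conjTranspose, Matrix.det_one] at h
    have h2 := congrArg norm h
    rw [norm_mul, norm_star, norm_one] at h2
    nlinarith [norm_nonneg U.det]
  obtain ⟨z, hz1, hz2⟩ : ∃ z : ℂ, z * star z = 1 ∧ z ^ N * U.det = 1 := by
    rcases Nat.eq_zero_or_pos N with rfl | hN
    · exact ⟨1, by simp, by simp⟩
    · have hN' : (N : ℂ) ≠ 0 := by exact_mod_cast hN.ne'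
      have harg := Complex.norm_mul_exp_arg_mul_I U.det
      rw [hd, Complex.ofReal_one, one_mul] at harg
      -- An `N`-th root of `(det U)⁻¹`, of modulus one.
      refine ⟨Complex.exp (((-U.det.arg / N : ℝ) : ℂ) * Complex.I), ?_, ?_⟩
      · have h := Complex.norm_exp_ofReal_mul_I (-U.det.arg / N : ℝ)
        rw [Complex.star_def, Complex.mul_conj, Complex.normSq_eq_norm_sq, h]
        simp
      · conv_lhs => rw [← harg]
        rw [← Complex.exp_nat_mul, harg]
        conv_lhs => enter [2]; rw [← harg]
        rw [← Complex.exp_add, Complex.exp_eq_one_iff]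
        refine ⟨0, ?_⟩
        push_cast
        field_simp
        ring
  refine ⟨z, hz1, Matrix.mem_specialUnitaryGroup_iff.2 ⟨Matrix.mem_unitaryGroup_iff.2 ?_, ?_⟩⟩
  · rw [star_smul, smul_mul_smul_comm, hz1, Matrix.mem_unitaryGroup_iff.1 hU, one_smul]
  · rw [Matrix.det_smul, Fintype.card_fin, hz2]

end Superoperators

/-! ### The correspondence between `exp ad` and `Ad exp`. -/

section MatrixExp

open NormedSpace
open scoped Matrix.Norms.Operator

theorem toMatrix_expUnit_adOp {Y : Matrix (Fin N) (Fin N) ℂ} (hY : Y.conjTranspose = -Y) (X : Her0 N) :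
    Her0.toMatrix ((expUnit (adOp Y hY) : SuperOp N) X) = exp Y * Her0.toMatrix X * (exp Y).conjTranspose := by
  have h := apply_exp_of_intertwine (LinearMap.toContinuousLinearMap (Her0.toMatrix (N := N)))
    (adOp Y hY) (adL Y) (fun v => by
      rw [adL_apply]; exact toMatrix_adOp Y hY v) X
  rw [← Matrix.exp_conjTranspose, hY]
  exact h.trans (exp_adL_apply _ _)

theorem exp_mem_unitaryGroup {Y : Matrix (Fin N) (Fin N) ℂ} (hY : Y.conjTranspose = -Y) :
    exp Y ∈ Matrix.unitaryGroup (Fin N) ℂ := by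
  rw [Matrix.mem_unitaryGroup_iff, Matrix.star_eq_conjTranspose, ← Matrix.exp_conjTranspose, hY]
  exact exp_mul_exp_neg Y

/-- `exp Y` is unitary, and a phase correcting its determinant drops out of the conjugation; thus
`Y` need not be traceless. -/
theorem expUnit_adOp_mem {Y : Matrix (Fin N) (Fin N) ℂ} (hY : Y.conjTranspose = -Y) :
    expUnit (adOp Y hY) ∈ (AdSU N).range := by
  obtain ⟨z, hz, hzU⟩ := exists_specialUnitary_smul (exp_mem_unitaryGroup hY)
  refine ⟨⟨z • exp Y, hzU⟩, Units.ext (SuperOp.ext_matrix fun X => ?_)⟩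
  rw [val_AdSU, toMatrix_conjSU, toMatrix_expUnit_adOp]
  simp only [Matrix.conjTranspose_smul, smul_mul_assoc, mul_smul_comm, smul_smul]
  rw [mul_comm, hz, one_smul]

theorem exists_expUnit_eq_AdSU {k : (SuperOp N)ˣ} (hk : k ∈ (AdSU N).range) :
    ∃ W ∈ adSu N, expUnit W = k := by
  obtain ⟨U, rfl⟩ := hk
  obtain ⟨Y, hY, hYU⟩ := exists_exp_eq_of_mem_unitaryGroup
    (Matrix.mem_specialUnitaryGroup_iff.1 U.2).1
  obtain ⟨Z, hZ, hZtr, hZY⟩ := exists_traceless_skew hY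
  refine ⟨adOp Z hZ, ⟨Z, hZ, hZtr, rfl⟩, Units.ext (SuperOp.ext_matrix fun X => ?_)⟩
  rw [hZY, toMatrix_expUnit_adOp, hYU]
  rfl

end MatrixExp

/-! ### Derivations of the matrix algebra. -/

section InnerDerivation

open Matrix

/-- Every derivation of the algebra of complex matrices is inner. -/
theorem exists_commutator_of_derivation
    (Φ : Matrix (Fin N) (Fin N) ℂ →ₗ[ℂ] Matrix (Fin N) (Fin N) ℂ)
    (hΦ : ∀ X Y, Φ (X * Y) = Φ X * Y + X * Φ Y) : ∃ Y, ∀ X, Φ X = Y * X - X * Y := by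
  rcases Nat.eq_zero_or_pos N with rfl | hN
  · exact ⟨0, fun X => Subsingleton.elim _ _⟩
  let o : Fin N := ⟨0, hN⟩
  refine ⟨∑ i, Φ (single i o 1) * single o i 1, fun X => ?_⟩
  have hone : ∑ i : Fin N, single i o (1 : ℂ) * single o i 1 = 1 := by
    simp_rw [single_mul_single_same, mul_one]
    ext a b
    rcases eq_or_ne a b with rfl | hab
    · simp [Matrix.sum_apply, single_apply]
    · rw [one_apply_ne hab, Matrix.sum_apply]
      exact Finset.sum_eq_zero fun i _ => by
        rw [single_apply, if_neg fun h => hab (h.1.symm.trans h.2)]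
  have hcol : ∀ i, X * single i o 1 = ∑ j, X j i • single j o (1 : ℂ) := by
    intro i
    ext a b
    simp only [Matrix.sum_apply, Matrix.smul_apply, single_apply, Matrix.mul_apply, smul_eq_mul]
    by_cases hb : o = b <;> simp [hb]
  have hrow : ∀ j, ∑ i, X j i • single o i (1 : ℂ) = single o j 1 * X := by
    intro j
    ext a b
    simp only [Matrix.sum_apply, Matrix.smul_apply, single_apply, Matrix.mul_apply, smul_eq_mul]
    by_cases ha : o = a <;> simp [ha]
  -- The sum is evaluated twice: by the Leibniz rule it is `Φ X + X Y`, by expanding columns and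
  -- linearity it is `Y X`.
  have h1 : ∑ i, Φ (X * single i o 1) * single o i 1 =
      Φ X + X * ∑ i, Φ (single i o 1) * single o i 1 := by
    simp_rw [hΦ, add_mul, Finset.sum_add_distrib, mul_assoc, ← Finset.mul_sum, hone, mul_one]
  have h2 : ∑ i, Φ (X * single i o 1) * single o i 1 =
      (∑ i, Φ (single i o 1) * single o i 1) * X := by
    simp_rw [hcol, map_sum, map_smul, Finset.sum_mul, smul_mul_assoc, mul_assoc, ← hrow,
      Finset.mul_sum, mul_smul_comm]
    exact Finset.sum_comm
  rw [← h2, h1, add_sub_cancel_right]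

end InnerDerivation

/-! ### Velocities of curves in `Ad SU(N)`. -/

section TangentAd

open Filter
open scoped Matrix.Norms.Operator

/-- Every matrix is a combination of traceless Hermitian matrices and the identity. -/
theorem exists_her0_decomposition (M : Matrix (Fin N) (Fin N) ℂ) :
    ∃ (X Y : Her0 N) (a : ℂ), M = Her0.toMatrix X + Complex.I • Her0.toMatrix Y + a • 1 := by
  have hherm : ∀ A : Matrix (Fin N) (Fin N) ℂ, A.conjTranspose = A →
      ∃ (X : Her0 N) (a : ℂ), A = Her0.toMatrix X + a • 1 := by
    intro A hA
    have htr : star A.trace = A.trace := by rw [← Matrix.trace_conjTranspose, hA]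
    refine ⟨⟨A - (A.trace / N) • 1, ?_, ?_⟩, A.trace / N, (sub_add_cancel _ _).symm⟩
    · rw [Matrix.conjTranspose_sub, hA, Matrix.conjTranspose_smul, Matrix.conjTranspose_one,
        star_div₀, htr]
      simp
    · rcases Nat.eq_zero_or_pos N with rfl | hN
      · simp [Matrix.trace]
      · have : (N : ℂ) ≠ 0 := by exact_mod_cast hN.ne'
        rw [Matrix.trace_sub, Matrix.trace_smul, Matrix.trace_one, Fintype.card_fin, smul_eq_mul,
          div_mul_cancel₀ _ this, sub_self]
  obtain ⟨X, a, hX⟩ := hherm ((2⁻¹ : ℂ) • (M + M.conjTranspose)) (by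
    simp [Matrix.conjTranspose_smul, add_comm])
  obtain ⟨Y, b, hY⟩ := hherm ((-Complex.I / 2) • (M - M.conjTranspose)) (by
    rw [Matrix.conjTranspose_smul, Matrix.conjTranspose_sub, Matrix.conjTranspose_conjTranspose,
      ← neg_sub M, smul_neg, ← neg_smul]
    simp [neg_div])
  refine ⟨X, Y, a + Complex.I * b, ?_⟩
  have e : M = (2⁻¹ : ℂ) • (M + M.conjTranspose) +
      Complex.I • ((-Complex.I / 2) • (M - M.conjTranspose)) := by
    rw [smul_smul, mul_div_assoc', mul_neg, Complex.I_mul_I, neg_neg, one_div, ← smul_add,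
      add_add_sub_cancel, ← two_smul ℂ M, smul_smul]
    norm_num
  rw [e, hX, hY, smul_add, smul_smul, add_smul]
  abel

/-- The velocity of a curve in `Ad SU(N)` through the identity lies in `ad su(N)`. -/
theorem mem_adSu_of_tendsto (u : ℝ → (SuperOp N)ˣ) (W : SuperOp N)
    (hu : ∀ t, 0 < t → u t ∈ (AdSU N).range)
    (hW : Tendsto (fun t : ℝ => t⁻¹ • ((u t : SuperOp N) - 1)) (𝓝[>] 0) (𝓝 W)) :
    W ∈ adSu N := by
  have hu' : ∀ t, ∃ U : Matrix.specialUnitaryGroup (Fin N) ℂ, 0 < t → AdSU N U = u t := by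
    intro t
    by_cases ht : 0 < t
    · obtain ⟨U, hU⟩ := hu t ht
      exact ⟨U, fun _ => hU⟩
    · exact ⟨1, fun h => absurd h ht⟩
  choose U hU using hu'
  set α : ℝ → Matrix (Fin N) (Fin N) ℂ → Matrix (Fin N) (Fin N) ℂ := fun t M =>
    (U t : Matrix (Fin N) (Fin N) ℂ) * M * (U t : Matrix (Fin N) (Fin N) ℂ).conjTranspose with hα
  have hUU : ∀ t, (U t : Matrix (Fin N) (Fin N) ℂ).conjTranspose *
      (U t : Matrix (Fin N) (Fin N) ℂ) = 1 := fun t =>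
    Matrix.mem_unitaryGroup_iff'.1 (Matrix.mem_specialUnitaryGroup_iff.1 (U t).2).1
  have hUU' : ∀ t, (U t : Matrix (Fin N) (Fin N) ℂ) *
      (U t : Matrix (Fin N) (Fin N) ℂ).conjTranspose = 1 := fun t =>
    Matrix.mem_unitaryGroup_iff.1 (Matrix.mem_specialUnitaryGroup_iff.1 (U t).2).1
  have hαadd : ∀ t M M', α t (M + M') = α t M + α t M' := fun t M M' => by
    simp only [hα, mul_add, add_mul]
  have hαsmul : ∀ t (z : ℂ) M, α t (z • M) = z • α t M := fun t z M => by
    simp only [hα, mul_smul_comm, smul_mul_assoc]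
  have hαone : ∀ t, α t 1 = 1 := fun t => by simp only [hα, mul_one, hUU']
  have hαmul : ∀ t M M', α t (M * M') = α t M * α t M' := fun t M M' => by
    simp only [hα, mul_assoc]
    rw [← mul_assoc _ (U t : Matrix (Fin N) (Fin N) ℂ) (M' * _), hUU, one_mul]
  set Q : ℝ → Matrix (Fin N) (Fin N) ℂ → Matrix (Fin N) (Fin N) ℂ := fun t M =>
    ((t⁻¹ : ℝ) : ℂ) • (α t M - M) with hQ
  have hQadd : ∀ t M M', Q t (M + M') = Q t M + Q t M' := fun t M M' => by
    simp only [hQ, hαadd, ← smul_add]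
    congr 1; abel
  have hQsmul : ∀ t (z : ℂ) M, Q t (z • M) = z • Q t M := fun t z M => by
    simp only [hQ, hαsmul, ← smul_sub]
    rw [smul_comm]
  have hlimH : ∀ X : Her0 N, Tendsto (fun t => Q t (Her0.toMatrix X)) (𝓝[>] 0)
      (𝓝 (Her0.toMatrix (W X))) := by
    intro X
    have h1 : Tendsto (fun t : ℝ => (t⁻¹ • ((u t : SuperOp N) - 1)) X) (𝓝[>] 0) (𝓝 (W X)) :=
      ((ContinuousLinearMap.apply ℝ (Her0 N) X).continuous.tendsto W).comp hW
    refine ((isClosedEmbedding_toMatrix.continuous.tendsto _).comp h1).congr' ?_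
    filter_upwards [self_mem_nhdsWithin] with t ht
    change Her0.toMatrix (t⁻¹ • ((u t : SuperOp N) X - X)) = _
    rw [← hU t ht, val_AdSU]
    rw [map_smul, map_sub, toMatrix_conjSU, hQ]
    ext a b
    simp [hα]
  -- The difference quotients extend complex-linearly from traceless Hermitian matrices to all
  -- matrices, with the identity contributing `0`. On the full algebra, multiplicativity of `α`
  -- makes the limit a derivation.
  have hlim : ∀ M, ∃ L, Tendsto (fun t => Q t M) (𝓝[>] 0) (𝓝 L) := by
    intro M
    obtain ⟨X, Y, a, rfl⟩ := exists_her0_decomposition M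
    refine ⟨Her0.toMatrix (W X) + Complex.I • Her0.toMatrix (W Y), ?_⟩
    refine ((hlimH X).add ((hlimH Y).const_smul Complex.I)).congr fun t => ?_
    rw [hQadd, hQadd, hQsmul, hQsmul]
    simp [hQ, hαone]
  choose Φ hΦ using hlim
  have hΦadd : ∀ M M', Φ (M + M') = Φ M + Φ M' := fun M M' =>
    tendsto_nhds_unique (hΦ _) (((hΦ M).add (hΦ M')).congr fun t => (hQadd t M M').symm)
  have hΦsmul : ∀ (z : ℂ) M, Φ (z • M) = z • Φ M := fun z M =>
    tendsto_nhds_unique (hΦ _) (((hΦ M).const_smul z).congr fun t => (hQsmul t z M).symm)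
  have hαlim : ∀ M, Tendsto (fun t => α t M) (𝓝[>] 0) (𝓝 M) := by
    intro M
    have h0 : Tendsto (fun t : ℝ => (t : ℂ)) (𝓝[>] 0) (𝓝 0) := by
      have := Complex.continuous_ofReal.tendsto 0
      rw [Complex.ofReal_zero] at this
      exact this.mono_left nhdsWithin_le_nhds
    have h1 := (h0.smul (hΦ M)).add_const M
    rw [zero_smul, zero_add] at h1
    refine h1.congr' ?_
    filter_upwards [self_mem_nhdsWithin] with t ht
    have ht0 : (t : ℂ) ≠ 0 := by exact_mod_cast (ne_of_gt ht)
    rw [hQ, smul_smul, Complex.ofReal_inv, mul_inv_cancel₀ ht0, one_smul, sub_add_cancel]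
  have hΦmul : ∀ M M', Φ (M * M') = Φ M * M' + M * Φ M' := by
    intro M M'
    refine tendsto_nhds_unique (hΦ _) ?_
    -- Discrete Leibniz rule: `Q(M M') = Q(M) α(M') + M Q(M')`.
    have h1 := ((hΦ M).mul (hαlim M')).add ((hΦ M').const_mul M)
    refine h1.congr fun t => ?_
    simp only [hQ, hαmul, smul_mul_assoc, mul_smul_comm, ← smul_add]
    congr 1
    noncomm_ring
  obtain ⟨Y, hY⟩ := exists_commutator_of_derivation
    { toFun := Φ, map_add' := hΦadd, map_smul' := hΦsmul } hΦmul
  have hWY : ∀ X : Her0 N, Her0.toMatrix (W X) = Y * Her0.toMatrix X - Her0.toMatrix X * Y :=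
    fun X => (tendsto_nhds_unique (hlimH X) (hΦ _)).trans (hY _)
  -- `W` preserves Hermitian matrices, so `-Y†` generates the same operator as `Y`; their average is
  -- skew-Hermitian.
  have hWY' : ∀ X : Her0 N, Her0.toMatrix (W X) =
      Her0.toMatrix X * Y.conjTranspose - Y.conjTranspose * Her0.toMatrix X := by
    intro X
    rw [← Her0.conjTranspose_coe (W X), hWY X, Matrix.conjTranspose_sub,
      Matrix.conjTranspose_mul, Matrix.conjTranspose_mul, Her0.conjTranspose_coe]
  have hskew : ((2⁻¹ : ℝ) • (Y - Y.conjTranspose)).conjTranspose =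
      -((2⁻¹ : ℝ) • (Y - Y.conjTranspose)) := by
    rw [Matrix.conjTranspose_smul, Matrix.conjTranspose_sub, Matrix.conjTranspose_conjTranspose,
      star_trivial, ← smul_neg, neg_sub]
  obtain ⟨Z, hZ, hZtr, hZY⟩ := exists_traceless_skew hskew
  refine ⟨Z, hZ, hZtr, SuperOp.ext_matrix fun X => ?_⟩
  rw [hZY, toMatrix_adOp, smul_mul_assoc, mul_smul_comm, ← smul_sub]
  have e : (Y - Y.conjTranspose) * Her0.toMatrix X - Her0.toMatrix X * (Y - Y.conjTranspose) =
      (2 : ℝ) • Her0.toMatrix (W X) := by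
    rw [two_smul]
    conv_rhs => enter [1]; rw [hWY]
    rw [hWY']
    noncomm_ring
  rw [e, smul_smul]
  norm_num

end TangentAd

/-! ### The cone of the theorem as a Cartan cone, and the conclusion. -/

section Main

theorem isCartanCone_of_lindblad (c : ProperCone ℝ (SuperOp N))
    (hpsd : ∀ C ∈ c, ContinuousLinearMap.IsPositive C)
    (hcc : ∀ C ∈ c, ∀ D ∈ c, C * D - D * C ∈ adSu N)
    (hck : ∀ C ∈ c, ∀ K ∈ adSu N, ∃ D ∈ c, ∃ E ∈ c, C * K - K * C = D - E)
    (hAd : ∀ U : Matrix.specialUnitaryGroup (Fin N) ℂ, ∀ C ∈ c,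
      (AdSU N U : SuperOp N) * C * (AdSU N U⁻¹ : SuperOp N) ∈ c) :
    IsCartanCone c (adSu N) (AdSU N).range where
  isPositive := hpsd
  commutator_mem := hcc
  commutator_mem_span C hC W hW := by
    obtain ⟨D, hD, E, hE, e⟩ := hck C hC W hW
    rw [e]
    exact Submodule.sub_mem _ (Submodule.subset_span hD) (Submodule.subset_span hE)
  conj_mem := by
    rintro _ ⟨U, rfl⟩ C hC
    rw [← map_inv]
    exact hAd U C hC
  star_eq_neg := by
    rintro _ ⟨Y, hY, -, rfl⟩
    exact star_adOp Y hY
  star_eq_inv := by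
    rintro _ ⟨U, rfl⟩
    rw [← map_inv]
    exact star_conjSU U
  expUnit_mem := by
    rintro _ ⟨Y, hY, -, rfl⟩
    exact expUnit_adOp_mem hY
  isCompact := isCompact_range_AdSU

theorem expConeAdSU_eq_expCone (c : ProperCone ℝ (SuperOp N)) :
    expConeAdSU (c : Set (SuperOp N)) = expCone c (AdSU N).range := by
  ext T
  constructor
  · rintro ⟨C, hC, U, rfl⟩; exact ⟨C, hC, _, ⟨U, rfl⟩, rfl⟩
  · rintro ⟨C, hC, _, ⟨U, rfl⟩, rfl⟩; exact ⟨C, hC, U, rfl⟩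

/-- The closure of the system semigroup is a Lie subsemigroup. -/
theorem isLieSubsemigroup_closure_systemSemigroup {m r : ℕ} (Hd : Her0 N) (H : Fin m → Her0 N)
    (V : Fin r → Matrix (Fin N) (Fin N) ℂ) :
    IsLieSubsemigroup (A := SuperOp N) (closure (systemSemigroup Hd H V : Set (SuperOp N)ˣ)) :=
  isLieSubsemigroup_closure_of_generators norm_one_clm_le (liouvillian Hd H V)

theorem adOp_smul_mem_adSu (X : Her0 N) (h) : adOp (Complex.I • Her0.toMatrix X) h ∈ adSu N :=
  ⟨_, h, by rw [Matrix.trace_smul, Her0.trace_coe, smul_zero], rfl⟩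

end Main

theorem mainTheorem3 (N m r : ℕ) (Hd : Her0 N) (H : Fin m → Her0 N)
    (V : Fin r → Matrix (Fin N) (Fin N) ℂ)
    (hunital : lindbladTerm V 1 = 0)
    (c : ProperCone ℝ (SuperOp N))
    (hpointed : ∀ C ∈ c, -C ∈ c → C = 0)
    (hpsd : ∀ C ∈ c, ContinuousLinearMap.IsPositive C)
    (hΓ : lindbladOp V ∈ c)
    (hcc : ∀ C ∈ c, ∀ D ∈ c, C * D - D * C ∈ adSu N)
    (hck : ∀ C ∈ c, ∀ K ∈ adSu N, ∃ D ∈ c, ∃ E ∈ c, C * K - K * C = D - E)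
    (hAd : ∀ U : Matrix.specialUnitaryGroup (Fin N) ℂ, ∀ C ∈ c,
      (AdSU N U : SuperOp N) * C * (AdSU N U⁻¹ : SuperOp N) ∈ c) :
    IsLieSubsemigroup (A := SuperOp N) (closure (systemSemigroup Hd H V : Set (SuperOp N)ˣ)) ∧
    closure (systemSemigroup Hd H V : Set (SuperOp N)ˣ) ⊆ expConeAdSU (c : Set (SuperOp N)) ∧
    IsLieSubsemigroup (A := SuperOp N) (expConeAdSU (c : Set (SuperOp N))) ∧
    tangentCone (A := SuperOp N) (expConeAdSU (c : Set (SuperOp N))) =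
      {T | ∃ C ∈ c, ∃ K ∈ adSu N, T = -C + K} ∧
    Disjoint (Submodule.span ℝ (c : Set (SuperOp N))) (adSu N) := by
  have h := isCartanCone_of_lindblad c hpsd hcc hck hAd
  rw [expConeAdSU_eq_expCone]
  refine ⟨isLieSubsemigroup_closure_systemSemigroup Hd H V,
    h.closure_generators_subset fun u => ⟨_, adOp_smul_mem_adSu _ _, _, hΓ, rfl⟩,
    h.isLieSubsemigroup fun k hk => exists_expUnit_eq_AdSU hk, ?_, h.disjoint_span⟩
  refine Subset.antisymm (fun g hg => h.exists_of_mem_tangentCone mem_adSu_of_tendsto hg) ?_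
  rintro _ ⟨C, hC, K, hK, rfl⟩
  exact h.neg_add_mem_tangentCone hC hK

end
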